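/- Let $0<\alpha<1$, $\beta>-1$ and $M>0$. There is a constant $C>0$, depending only on $\alpha$, $\beta$ and $M$, such that the following holds. Let $X,Y$ be complex Banach spaces (the scalar case is $X=Y=\mathbb C$), and let $K$ be a function on $\mathbb C\setminus(-\infty,0]$ with values in the bounded linear operators $X\to Y$, such that 1. $K$ is holomorphic on $\mathbb C\setminus(-\infty,0]$; 2. $\|K(z)\|\le M|z|^{-\alpha}$ for all $z\in\mathbb C\setminus(-\infty,0]$; 3. $K$ extends continuously from $\{\operatorname{Im}z>0\}$ to $\{\operatorname{Im} z\ge 0\}\setminus\{0\}$, and from $\{\operatorname{Im}z<0\}$ to $\{\operatorname{Im} z\le 0\}\setminus\{0\}$, with boundary values denoted by $K(e^{i\pi}x)$ and $K(e^{-i\pi}x)$, $x>0$. Let $k$ be a kernel on $(0,\infty)$ with Laplace transform $K$, that is, $K(z)=\int_0^\infty e^{-zt}k(t)\,dt$ (absolutely convergent) in some half-plane $\operatorname{Re}z>\sigma$, and put $c(t)=\int_0^t k(t-s)f(s)\,ds$. For a mesh $0=t_0<t_1<\dots<t_N=T$ with steps $\tau_j=t_j-t_{j-1}$, let $c_n$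 be the generalized convolution quadrature based on the implicit Euler method, $$c_n=\int_0^\infty G(x)\,y_n(x)\,dx,\qquad y_n(x)=\sum_{j=1}^n\tau_j\Bigl(\prod_{\ell=j}^n\frac1{1+\tau_\ell x}\Bigr)f(t_j),\qquad G(x)=\frac{K(e^{-i\pi}x)-K(e^{i\pi}x)}{2\pi i}.$$ Let $f^{(\mu)}$ denote the Riemann–Liouville derivative on $(0,T]$, $f^{(\mu)}=\frac{d^\rho}{dt^\rho}\mathcal I^{\rho-\mu}[f]$ with $\rho=\lfloor\mu\rfloor+1$, where $\mathcal I^{\nu}[f](t)=\frac1{\Gamma(\nu)}\int_0^t(t-s)^{\nu-1}f(s)\,ds$ and the derivative at $T$ is one-sided (for $-1<\mu<0$ this is $\mathcal I^{-\mu}[f]$), and let $f^{(\mu)}(0)=\lim_{t\to0^+}f^{(\mu)}(t)$. Let $p\in\mathbb N$ with $p>1-\beta$. Assume that $f^{(p+\beta+1)}$ is bounded on $(0,T]$ and that $f$, with values in $X$, satisfies, for $t\in(0,T]$, $$f(t)=\sum_{\ell=0}^p\frac{f^{(\ell+\beta)}(0)}{\Gamma(\ell+\beta+1)}t^{\ell+\beta}+\frac1{\Gamma(p+\beta+1)}\int_0^t(t-s)^{p+\beta}f^{(p+\beta+1)}(s)\,ds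 .$$ Then there exist $\xi_j\in(t_{j-1},t_j)$, $2\le j\le N$, such that for all $1\le n\le N$ $$\begin{aligned}\|c(t_n)-c_n\|\le{}& C\sum_{\ell=0}^p\Bigl(\tau_1^{\ell+\alpha+\beta}+\sum_{j=2}^n\tau_j^2\,\xi_j^{\ell+\alpha+\beta-2}\Bigr)\bigl\|f^{(\ell+\beta)}(0)\bigr\|\\&+C\Bigl(\tau_1^{p+\alpha+\beta+1}\sup_{0<t\le t_1}\|f^{(p+\beta+1)}(t)\|+\sum_{j=2}^n\tau_j^2\,\xi_j^{p+\alpha+\beta-1}\sup_{0<t\le t_j}\|f^{(p+\beta+1)}(t)\|\Bigr).\end{aligned}$$ -/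

import Mathlib

open Set Filter Topology MeasureTheory

noncomputable section

/-- Values of `K` continued continuously from the open upper half plane (so that the value at
`-x`, `x > 0`, is `K (e^{iπ} x)`, on the upper edge of the cut). -/
def upperExt {E : Type*} [TopologicalSpace E] (K : ℂ → E) : ℂ → E :=
  extendFrom {z : ℂ | 0 < z.im} K

/-- Values of `K` continued continuously from the open lower half plane (so that the value at
`-x`, `x > 0`, is `K (e^{-iπ} x)`, on the lower edge of the cut). -/
def lowerExt {E : Type*} [TopologicalSpace E] (K : ℂ → E) : ℂ → E :=
  extendFrom {z : ℂ | z.im < 0} K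

/-- Sectorial symbols of order `α`, with the constant `M`. Only the values of `K` on the plane cut
along `(-∞, 0]` matter. -/
structure SectorialSymbol {E : Type*} [NormedAddCommGroup E] [NormedSpace ℂ E]
    (α M : ℝ) (K : ℂ → E) : Prop where
  holomorphic : DifferentiableOn ℂ K Complex.slitPlane
  bound : ∀ z ∈ Complex.slitPlane, ‖K z‖ ≤ M * ‖z‖ ^ (-α)
  continuous_upper : ContinuousOn (upperExt K) ({z : ℂ | 0 ≤ z.im} \ {0})
  continuous_lower : ContinuousOn (lowerExt K) ({z : ℂ | z.im ≤ 0} \ {0})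

/-- `K` is the Laplace transform of `k`, in some half plane `Re z > σ`. -/
def IsLaplaceTransform {E : Type*} [NormedAddCommGroup E] [NormedSpace ℂ E]
    (k : ℝ → E) (K : ℂ → E) : Prop :=
  ∃ σ : ℝ, ∀ z : ℂ, σ < z.re →
    IntegrableOn (fun t : ℝ => Complex.exp (-z * (t : ℂ)) • k t) (Ioi 0) ∧
    K z = ∫ t in Ioi (0 : ℝ), Complex.exp (-z * (t : ℂ)) • k t

/-- The density `G(x) = (K(e^{-iπ} x) - K(e^{iπ} x)) / (2πi)`, for `x > 0`. -/
def cutDensity {E : Type*} [NormedAddCommGroup E] [NormedSpace ℂ E] (K : ℂ → E) (x : ℝ) : E :=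
  (1 / (2 * (Real.pi : ℂ) * Complex.I)) • (lowerExt K (-(x : ℂ)) - upperExt K (-(x : ℂ)))

/-- The points `0 = t 0 < t 1 < ⋯ < t N = T`. -/
structure IsTimeMesh (t : ℕ → ℝ) (N : ℕ) (T : ℝ) : Prop where
  zero : t 0 = 0
  step : ∀ j < N, t j < t (j + 1)
  last : t N = T

/-- The step sizes `τ_j = t_j - t_{j-1}`, for `j ≥ 1`. -/
def stepSize (t : ℕ → ℝ) (j : ℕ) : ℝ := t j - t (j - 1)

section Convolution

variable {X Y : Type*} [NormedAddCommGroup X] [NormedSpace ℂ X]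
  [NormedAddCommGroup Y] [NormedSpace ℂ Y]

/-- The convolution `c(t) = ∫_0^t k(t - s) f(s) ds`. -/
def convolve (k : ℝ → X →L[ℂ] Y) (f : ℝ → X) (t : ℝ) : Y :=
  ∫ s in (0 : ℝ)..t, k (t - s) (f s)

/-- The implicit Euler approximation `y_n(x)` to `y' = -x y + f`, `y(0) = 0`, at time `t_n`. -/
def eulerApprox (t : ℕ → ℝ) (f : ℝ → X) (n : ℕ) (x : ℝ) : X :=
  ∑ j ∈ Finset.Icc 1 n,
    (stepSize t j * ∏ l ∈ Finset.Icc j n, 1 / (1 + stepSize t l * x)) • f (t j)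

/-- The first-order generalized convolution quadrature `c_n = ∫_0^∞ G(x) y_n(x) dx`. -/
def gCQ (K : ℂ → X →L[ℂ] Y) (t : ℕ → ℝ) (f : ℝ → X) (n : ℕ) : Y :=
  ∫ x in Ioi (0 : ℝ), cutDensity K x (eulerApprox t f n x)

end Convolution

section Fractional

variable {X : Type*} [NormedAddCommGroup X] [NormedSpace ℝ X]

/-- The fractional integral of order `ν > 0`. -/
def fracInt (ν : ℝ) (f : ℝ → X) (t : ℝ) : X :=
  (1 / Real.Gamma ν) • ∫ s in (0 : ℝ)..t, (t - s) ^ (ν - 1) • f s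

/-- The Riemann-Liouville derivative `f^{(μ)}(t) = d^ρ/dt^ρ I^{ρ-μ}[f](t)` on `(0, T]` (one-sided
at `T`), where `ρ - 1 ≤ μ < ρ` for `μ ≥ 0`. For `μ < 0` one has `ρ = 0` and this is the fractional
integral of order `-μ`; for `μ = 0` it is the derivative of the integral of `f`. -/
def rlDeriv (T μ : ℝ) (f : ℝ → X) (t : ℝ) : X :=
  iteratedDerivWithin (⌊μ⌋ + 1).toNat
    (fracInt (((⌊μ⌋ + 1).toNat : ℝ) - μ) f) (Ioc 0 T) t

/-- `f^{(μ)}(0)`, the limit of `f^{(μ)}(t)` as `t` decreases to `0`. -/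
def rlDerivZero (T μ : ℝ) (f : ℝ → X) : X :=
  limUnder (𝓝[>] (0 : ℝ)) (rlDeriv T μ f)

/-- The supremum of `‖g‖` on `(0, b]`. -/
def supNorm (g : ℝ → X) (b : ℝ) : ℝ :=
  ⨆ s : Ioc (0 : ℝ) b, ‖g s‖

end Fractional

end

noncomputable section

/-! The proof diagonalises the convolution into scalar relaxation equations. Cauchy's theorem on a
keyhole contour gives `K z = ∫ G(x) / (x + z) dx` for `Re z > 0`
(`eq_integral_inv_add_smul_cutDensity`), so by uniqueness of Laplace transforms `k(t) = ∫ e^{-xt}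
G(x) dx` for almost every `t > 0` (`ae_eq_cutKernel`). Fubini then yields `c(t_n) = ∫ G(x) y(x, t_n)
dx`, where `y' = -x y + f` and `y(0) = 0`. The quadrature is the same integral with `y` replaced by
its implicit Euler approximation. Since `‖G(x)‖ ≤ (M/π) x^{-α}`, everything reduces to the Euler
error, with control of its decay in `x`.

That error is a sum over steps of amplification factor times local defect
(`expConv_sub_eulerApprox`). Only the factor `1/(1 + τ_j x)` of the step itself is kept. The aim is
a bound `A_j / (1 + x t_j)` for step `j`, because `∫ x^{-α} / (1 + x t_j) dx` is a constant times
`t_j^{α-1}` (`norm_convolve_sub_gCQ_le`).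

The fractional Taylor formula splits `f` into powers and a remainder. For `s^γ` the defect is
controlled through `|y''(s)| ≤ C s^{γ-1} / (1 + xs)` (`abs_expConvRpowDeriv2_le`), with a direct
estimate for the step starting at `0`. The remainder is the primitive of a Lipschitz function
vanishing on the negative axis, and translating the convolution gives its defect
(`norm_eulerDefect_primitive_le`). The same argument for large powers produces constants growing no
faster than `Γ(γ+1)`, which the Taylor coefficients cancel, so the final constant does not depend on
`p`.

The outcome is `τ_j² t_j^{l+α+β-2}` per step; `ξ_j` is chosen so near `t_j` that replacing `t_j` by
it costs at most a factor `2`. -/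

/-- The solution `y(s) = ∫_0^s e^{-x(s-u)} f(u) du` of `y' = -x y + f`, `y(0) = 0`. -/
def expConv {X : Type*} [NormedAddCommGroup X] [NormedSpace ℝ X]
    (x : ℝ) (f : ℝ → X) (s : ℝ) : X :=
  ∫ u in (0 : ℝ)..s, Real.exp (-x * (s - u)) • f u

/-- The local defect of the implicit Euler step from `a` to `b`. -/
def eulerDefect {X : Type*} [NormedAddCommGroup X] [NormedSpace ℝ X]
    (x : ℝ) (f : ℝ → X) (a b : ℝ) : X :=
  expConv x f b - expConv x f a - (b - a) • (f b - x • expConv x f b)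

/-! ### Error propagation for implicit Euler -/

section Euler

variable {X : Type*} [NormedAddCommGroup X] [NormedSpace ℂ X]

/-- The amplification factor of the Euler steps `j, …, n`. -/
def eulerFactor (t : ℕ → ℝ) (x : ℝ) (j n : ℕ) : ℝ :=
  ∏ l ∈ Finset.Icc j n, 1 / (1 + stepSize t l * x)

theorem eulerFactor_succ (t : ℕ → ℝ) (x : ℝ) {j n : ℕ} (h : j ≤ n + 1) :
    eulerFactor t x j (n + 1)
      = eulerFactor t x j n * (1 / (1 + stepSize t (n + 1) * x)) := by
  rw [eulerFactor, Finset.prod_Icc_succ_top h, eulerFactor]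

/-- The error `e_n` obeys `(1 + τ_{n+1} x) e_{n+1} = e_n + defect`, because the exact solution
satisfies the Euler equation up to its defect. Unrolling the recursion gives the sum. -/
theorem expConv_sub_eulerApprox (t : ℕ → ℝ) (f : ℝ → X) (x : ℝ) (ht : t 0 = 0) (n : ℕ)
    (h : ∀ j, 1 ≤ j → j ≤ n → 1 + stepSize t j * x ≠ 0) :
    expConv x f (t n) - eulerApprox t f n x
      = ∑ j ∈ Finset.Icc 1 n, eulerFactor t x j n • eulerDefect x f (t (j - 1)) (t j) := by
  induction n with
  | zero => simp [eulerApprox, ht, expConv]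
  | succ n ih =>
    have ih' := ih fun j h1 h2 => h j h1 (by omega)
    have hne := h (n + 1) (by omega) le_rfl
    set q : ℝ := 1 / (1 + stepSize t (n + 1) * x) with hq
    have hq1 : q * (1 + stepSize t (n + 1) * x) = 1 := by rw [hq]; field_simp
    have e0 : eulerFactor t x (n + 1) n = 1 := by simp [eulerFactor]
    have e1 : eulerApprox t f (n + 1) x
        = q • (eulerApprox t f n x + stepSize t (n + 1) • f (t (n + 1))) := by
      unfold eulerApprox
      rw [Finset.sum_Icc_succ_top (by omega), smul_add, Finset.smul_sum]
      congr 1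
      · refine Finset.sum_congr rfl fun j hj => ?_
        rw [Finset.mem_Icc] at hj
        rw [Finset.prod_Icc_succ_top (by omega), smul_smul]
        congr 1
        rw [hq]; ring
      · simp [smul_smul, hq, mul_comm]
    have e2 : ∑ j ∈ Finset.Icc 1 (n + 1),
          eulerFactor t x j (n + 1) • eulerDefect x f (t (j - 1)) (t j)
        = q • (∑ j ∈ Finset.Icc 1 n, eulerFactor t x j n • eulerDefect x f (t (j - 1)) (t j)
          + eulerDefect x f (t n) (t (n + 1))) := by
      rw [Finset.sum_Icc_succ_top (by omega), smul_add, Finset.smul_sum]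
      congr 1
      · refine Finset.sum_congr rfl fun j hj => ?_
        rw [Finset.mem_Icc] at hj
        rw [eulerFactor_succ t x (by omega), smul_smul, mul_comm]
      · rw [eulerFactor_succ t x le_rfl, e0, one_mul, Nat.add_sub_cancel]
    rw [e1, e2, ← ih']
    have hs : stepSize t (n + 1) = t (n + 1) - t n := by simp [stepSize]
    have : expConv x f (t (n + 1))
        = q • ((1 + stepSize t (n + 1) * x) • expConv x f (t (n + 1))) := by
      rw [smul_smul, hq1, one_smul]
    nth_rewrite 1 [this]
    rw [eulerDefect, ← smul_sub, ← hs]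
    congr 1
    module

theorem eulerFactor_nonneg {t : ℕ → ℝ} {x : ℝ} {j n : ℕ} (hx : 0 ≤ x)
    (h : ∀ l, j ≤ l → l ≤ n → 0 ≤ stepSize t l) : 0 ≤ eulerFactor t x j n := by
  refine Finset.prod_nonneg fun l hl => ?_
  rw [Finset.mem_Icc] at hl
  have := mul_nonneg (h l hl.1 hl.2) hx
  positivity

theorem eulerFactor_le {t : ℕ → ℝ} {x : ℝ} {j n : ℕ} (hx : 0 ≤ x) (hj : j ≤ n)
    (h : ∀ l, j ≤ l → l ≤ n → 0 ≤ stepSize t l) :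
    eulerFactor t x j n ≤ 1 / (1 + stepSize t j * x) := by
  have hmem : j ∈ Finset.Icc j n := by simp [hj]
  rw [eulerFactor, ← Finset.mul_prod_erase _ _ hmem]
  have := mul_nonneg (h j le_rfl hj) hx
  refine mul_le_of_le_one_right (by positivity) (Finset.prod_le_one ?_ ?_) <;>
  · intro l hl
    rw [Finset.mem_erase, Finset.mem_Icc] at hl
    have := mul_nonneg (h l hl.2.1 hl.2.2) hx
    first | positivity | exact div_le_one_of_le₀ (by linarith) (by linarith)

end Euler

/-! ### The exponential convolution and elementary kernel bounds -/

section ExpConv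

variable {X : Type*} [NormedAddCommGroup X] [NormedSpace ℝ X]

theorem expConv_eq_exp_smul (x : ℝ) (f : ℝ → X) (s : ℝ) :
    expConv x f s = Real.exp (-x * s) • ∫ u in (0 : ℝ)..s, Real.exp (x * u) • f u := by
  rw [expConv, ← intervalIntegral.integral_smul]
  congr 1
  funext u
  rw [smul_smul, ← Real.exp_add]
  congr 2
  ring

theorem hasDerivAt_expConv [CompleteSpace X] {f : ℝ → X} (x : ℝ) {s : ℝ}
    (hi : IntervalIntegrable f volume 0 s) {U : Set ℝ} (hU : IsOpen U)
    (hc : ContinuousOn f U) (hs : s ∈ U) :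
    HasDerivAt (expConv x f) (f s - x • expConv x f s) s := by
  have hcont : Continuous fun u : ℝ => Real.exp (x * u) := by fun_prop
  have hc' : ContinuousOn (fun u => Real.exp (x * u) • f u) U := hcont.continuousOn.smul hc
  have h1 : HasDerivAt (fun v => ∫ u in (0 : ℝ)..v, Real.exp (x * u) • f u)
      (Real.exp (x * s) • f s) s :=
    intervalIntegral.integral_hasDerivAt_right (hi.continuousOn_smul hcont.continuousOn)
      (hc'.stronglyMeasurableAtFilter hU s hs) (hc'.continuousAt (hU.mem_nhds hs))
  have h2 : HasDerivAt (fun v : ℝ => Real.exp (-x * v)) (Real.exp (-x * s) * -x) s := by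
    have := ((hasDerivAt_id s).const_mul (-x)).exp
    simpa using this
  have h3 := h2.smul h1
  have e : expConv x f = fun v => Real.exp (-x * v) • ∫ u in (0 : ℝ)..v, Real.exp (x * u) • f u :=
    funext fun v => expConv_eq_exp_smul x f v
  rw [e]
  convert! h3 using 1
  rw [smul_smul (Real.exp (-x * s)) (Real.exp (x * s)), ← Real.exp_add,
    show -x * s + x * s = 0 by ring, Real.exp_zero, one_smul]
  module

end ExpConv

theorem integral_exp_neg_mul_sub (x a b : ℝ) :
    x * ∫ u in a..b, Real.exp (-x * (b - u)) = 1 - Real.exp (-x * (b - a)) := by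
  have : ∀ u ∈ uIcc a b, HasDerivAt (fun u => Real.exp (-x * (b - u)))
      (x * Real.exp (-x * (b - u))) u := fun u _ => by
    have := (((hasDerivAt_id u).const_sub b).const_mul (-x)).exp
    convert! this using 1
    simp [mul_comm]
  rw [← intervalIntegral.integral_const_mul,
    intervalIntegral.integral_eq_sub_of_hasDerivAt this
      (Continuous.intervalIntegrable (by fun_prop) _ _)]
  simp

/-- The integral `I` satisfies both `I ≤ b` and `x I ≤ 1`; adding the first to `b` times the second
gives `(1 + xb) I ≤ 2b`, uniformly from small to large `x`. -/
theorem integral_exp_neg_mul_sub_le {x a b : ℝ} (hx : 0 ≤ x) (ha : 0 ≤ a) (hab : a ≤ b) :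
    ∫ u in a..b, Real.exp (-x * (b - u)) ≤ 2 * b / (1 + x * b) := by
  have hb := ha.trans hab
  have h1 : x * ∫ u in a..b, Real.exp (-x * (b - u)) ≤ 1 := by
    rw [integral_exp_neg_mul_sub]
    linarith [Real.exp_pos (-x * (b - a))]
  have h2 : ∫ u in a..b, Real.exp (-x * (b - u)) ≤ b := by
    calc _ ≤ ∫ u in a..b, (1 : ℝ) := by
          refine intervalIntegral.integral_mono_on hab
            (Continuous.intervalIntegrable (by fun_prop) _ _) (by simp) fun u hu => ?_
          rw [Real.exp_le_one_iff]
          nlinarith [hu.2]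
      _ ≤ b := by simp; linarith
  rw [le_div_iff₀ (by positivity)]
  nlinarith

theorem exp_neg_half_mul_sq_le {r : ℝ} (hr : 0 ≤ r) :
    Real.exp (-(r / 2)) * (1 + r) ^ 2 ≤ 216 / (1 + r) := by
  -- Cubing this inequality is the source of `216 = 6³`.
  have h1 : (1 + r) / 6 ≤ Real.exp (r / 6) := by
    linarith [Real.add_one_le_exp (r / 6)]
  have h2 : (1 + r) ^ 3 ≤ 216 * Real.exp (r / 2) := by
    have : Real.exp (r / 2) = Real.exp (r / 6) ^ 3 := by
      rw [← Real.exp_nat_mul]; congr 1; push_cast; ring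
    rw [this]
    have := pow_le_pow_left₀ (by positivity) h1 3
    nlinarith
  rw [le_div_iff₀ (by positivity), Real.exp_neg, mul_assoc, inv_mul_le_iff₀ (Real.exp_pos _)]
  nlinarith

theorem rpow_le_of_half_le {s u : ℝ} (δ : ℝ) (hs : 0 < s) (h1 : s / 2 ≤ u) (h2 : u ≤ s) :
    u ^ δ ≤ 2 ^ |δ| * s ^ δ := by
  have hu : 0 < u := by linarith
  rcases le_or_gt 0 δ with hδ | hδ
  · have h3 : u ^ δ ≤ s ^ δ := Real.rpow_le_rpow hu.le h2 hδ
    have h4 : (1 : ℝ) ≤ 2 ^ |δ| := Real.one_le_rpow (by norm_num) (abs_nonneg _)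
    have := Real.rpow_nonneg hs.le δ
    nlinarith
  · have h3 : u ^ δ ≤ (s / 2) ^ δ :=
      Real.rpow_le_rpow_of_nonpos (by linarith) h1 hδ.le
    rwa [Real.div_rpow hs.le (by norm_num), abs_of_neg hδ, Real.rpow_neg (by norm_num),
      inv_mul_eq_div] at *

/-! ### Solution and Euler defect for a power source -/

section Power

variable {γ : ℝ}

theorem integral_rpow_le_mul {a b : ℝ} (hγ : -1 < γ) (ha : 0 < a) (hab : a ≤ b) :
    ∫ s in a..b, s ^ γ ≤ (1 + 1 / (γ + 1)) * ((b - a) * b ^ γ) := by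
  have hb := ha.trans_le hab
  have hγ' : 0 < γ + 1 := by linarith
  have hp : 0 ≤ (b - a) * b ^ γ := mul_nonneg (by linarith) (Real.rpow_nonneg hb.le _)
  have hpos : 0 ≤ 1 / (γ + 1) := by positivity
  rcases le_or_gt 0 γ with h | h
  · have : ∫ s in a..b, s ^ γ ≤ ∫ s in a..b, b ^ γ :=
      intervalIntegral.integral_mono_on hab (intervalIntegral.intervalIntegrable_rpow' hγ) (by simp)
        fun u hu => Real.rpow_le_rpow (by linarith [hu.1]) hu.2 h
    rw [intervalIntegral.integral_const, smul_eq_mul] at this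
    nlinarith
  · rw [integral_rpow (Or.inl hγ)]
    have h1 : b ^ γ ≤ a ^ γ := Real.rpow_le_rpow_of_nonpos ha hab h.le
    have h2 : b ^ (γ + 1) - a ^ (γ + 1) ≤ (b - a) * b ^ γ := by
      rw [Real.rpow_add_one hb.ne', Real.rpow_add_one ha.ne']
      nlinarith
    have := mul_le_mul_of_nonneg_left h2 hpos
    rw [div_eq_inv_mul, inv_eq_one_div]
    linarith

theorem expConv_rpow_nonneg (x : ℝ) {s : ℝ} (hs : 0 ≤ s) :
    0 ≤ expConv x (fun u => u ^ γ) s :=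
  intervalIntegral.integral_nonneg hs fun _ hu =>
    smul_nonneg (Real.exp_pos _).le (Real.rpow_nonneg hu.1 _)

/-- Splitting at `s / 2` separates the two effects: on the left half the exponential is at most
`e^{-xs/2}` and the power is integrable; on the right half the power is comparable to `s^γ` and the
exponential is integrated. -/
theorem expConv_rpow_le (hγ : -1 < γ) : ∃ C : ℝ, 0 ≤ C ∧ ∀ x s : ℝ, 0 ≤ x → 0 < s →
    expConv x (fun u => u ^ γ) s ≤ C * (s ^ (γ + 1) / (1 + x * s)) := by
  have hγ' : 0 < γ + 1 := by linarith
  refine ⟨216 / (γ + 1) + 2 * 2 ^ |γ|, by positivity, fun x s hx hs => ?_⟩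
  have hii : ∀ a b : ℝ, IntervalIntegrable (fun u : ℝ => u ^ γ) volume a b := fun a b =>
    intervalIntegral.intervalIntegrable_rpow' hγ
  have hi : ∀ a b : ℝ,
      IntervalIntegrable (fun u : ℝ => Real.exp (-x * (s - u)) • u ^ γ) volume a b :=
    fun a b => (hii a b).continuousOn_smul (Continuous.continuousOn (by fun_prop))
  have hx0 : 0 ≤ x * s := by positivity
  rw [expConv, ← intervalIntegral.integral_add_adjacent_intervals (hi 0 (s / 2)) (hi (s / 2) s),
    add_mul]
  refine add_le_add ?_ ?_
  · calc ∫ u in (0 : ℝ)..s / 2, Real.exp (-x * (s - u)) • u ^ γ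
        ≤ ∫ u in (0 : ℝ)..s / 2, Real.exp (-(x * s / 2)) * u ^ γ := by
          refine intervalIntegral.integral_mono_on (by linarith) (hi _ _)
            ((hii _ _).const_mul _) fun u hu => ?_
          refine mul_le_mul_of_nonneg_right (Real.exp_le_exp.2 ?_) (Real.rpow_nonneg hu.1 _)
          nlinarith [hu.2]
      _ = Real.exp (-(x * s / 2)) * ((s / 2) ^ (γ + 1) / (γ + 1)) := by
          rw [intervalIntegral.integral_const_mul, integral_rpow (Or.inl hγ),
            Real.zero_rpow hγ'.ne', sub_zero]
      _ ≤ (216 / (1 + x * s)) * (s ^ (γ + 1) / (γ + 1)) := by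
          have h1 : Real.exp (-(x * s / 2)) ≤ 216 / (1 + x * s) := by
            refine le_trans ?_ (exp_neg_half_mul_sq_le hx0)
            exact le_mul_of_one_le_right (Real.exp_pos _).le (one_le_pow₀ (by linarith))
          have h2 : (s / 2) ^ (γ + 1) ≤ s ^ (γ + 1) :=
            Real.rpow_le_rpow (by linarith) (by linarith) hγ'.le
          have := Real.rpow_nonneg (show 0 ≤ s / 2 by linarith) (γ + 1)
          gcongr
      _ = _ := by ring
  · calc ∫ u in s / 2..s, Real.exp (-x * (s - u)) • u ^ γ
        ≤ ∫ u in s / 2..s, Real.exp (-x * (s - u)) * (2 ^ |γ| * s ^ γ) := by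
          refine intervalIntegral.integral_mono_on (by linarith) (hi _ _)
            (Continuous.intervalIntegrable (by fun_prop) _ _) fun u hu => ?_
          exact mul_le_mul_of_nonneg_left (rpow_le_of_half_le γ hs hu.1 hu.2) (Real.exp_pos _).le
      _ ≤ (2 * s / (1 + x * s)) * (2 ^ |γ| * s ^ γ) := by
          rw [intervalIntegral.integral_mul_const]
          have := Real.rpow_nonneg hs.le γ
          exact mul_le_mul_of_nonneg_right
            (integral_exp_neg_mul_sub_le hx (by linarith) (by linarith)) (by positivity)
      _ = _ := by rw [Real.rpow_add_one hs.ne']; ring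

/-- The second derivative of `expConv x (· ^ γ)`. -/
def expConvRpowDeriv2 (γ x s : ℝ) : ℝ :=
  γ * s ^ (γ - 1) - x * s ^ γ + x ^ 2 * expConv x (fun u => u ^ γ) s

theorem continuousOn_rpow_Ioi (δ : ℝ) : ContinuousOn (fun u : ℝ => u ^ δ) (Ioi 0) := fun u hu =>
  (Real.continuousAt_rpow_const u δ (Or.inl (ne_of_gt hu))).continuousWithinAt

theorem hasDerivAt_expConv_rpow (hγ : -1 < γ) (x : ℝ) {s : ℝ} (hs : 0 < s) :
    HasDerivAt (expConv x fun u => u ^ γ) (s ^ γ - x * expConv x (fun u => u ^ γ) s) s :=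
  hasDerivAt_expConv x (intervalIntegral.intervalIntegrable_rpow' hγ) isOpen_Ioi (continuousOn_rpow_Ioi γ)
    hs

theorem hasDerivAt_rpow_sub_expConv (hγ : -1 < γ) (x : ℝ) {s : ℝ} (hs : 0 < s) :
    HasDerivAt (fun s => s ^ γ - x * expConv x (fun u => u ^ γ) s) (expConvRpowDeriv2 γ x s) s := by
  have h1 := Real.hasDerivAt_rpow_const (x := s) (p := γ) (Or.inl hs.ne')
  convert! h1.sub ((hasDerivAt_expConv_rpow hγ x hs).const_mul x) using 1
  rw [expConvRpowDeriv2]; ring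

theorem hasDerivAt_expConvRpowDeriv2 (hγ : -1 < γ) (x : ℝ) {s : ℝ} (hs : 0 < s) :
    HasDerivAt (expConvRpowDeriv2 γ x)
      (γ * ((γ - 1) * s ^ (γ - 2)) - x * expConvRpowDeriv2 γ x s) s := by
  have h1 := (Real.hasDerivAt_rpow_const (x := s) (p := γ - 1) (Or.inl hs.ne')).const_mul γ
  have h2 := (Real.hasDerivAt_rpow_const (x := s) (p := γ) (Or.inl hs.ne')).const_mul x
  have h3 := (hasDerivAt_expConv_rpow hγ x hs).const_mul (x ^ 2)
  convert! (h1.sub h2).add h3 using 1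
  rw [expConvRpowDeriv2, show γ - 1 - 1 = γ - 2 by ring]; ring

/-- The second derivative `q` solves `q' = -x q + γ(γ-1) s^{γ-2}`, whose source need not be
integrable at `0`. Variation of constants is therefore started at `s / 2`. The value there may be as
large as `s^{γ-1} (1 + xs)²`, but the damping `e^{-xs/2}` absorbs the quadratic factor. -/
theorem abs_expConvRpowDeriv2_le (hγ : -1 < γ) : ∃ C : ℝ, 0 ≤ C ∧ ∀ x s : ℝ, 0 ≤ x → 0 < s →
    |expConvRpowDeriv2 γ x s| ≤ C * (s ^ (γ - 1) / (1 + x * s)) := by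
  obtain ⟨C, hC, hy⟩ := expConv_rpow_le hγ
  refine ⟨216 * ((|γ| + 1 + C) * 2 ^ |γ - 1|) + 2 * (|γ * (γ - 1)| * 2 ^ |γ - 2|), by positivity,
    fun x s hx hs => ?_⟩
  have hm : 0 < s / 2 := by linarith
  have hx0 : 0 ≤ x * s := by positivity
  have hd : ∀ u ∈ uIcc (s / 2) s, HasDerivAt (fun u => Real.exp (-x * (s - u)) *
      expConvRpowDeriv2 γ x u) (Real.exp (-x * (s - u)) * (γ * (γ - 1) * u ^ (γ - 2))) u := by
    intro u hu
    rw [uIcc_of_le (by linarith)] at hu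
    have hu0 : 0 < u := by linarith [hu.1]
    have h1 := (((hasDerivAt_id u).const_sub s).const_mul (-x)).exp
    convert! h1.mul (hasDerivAt_expConvRpowDeriv2 hγ x hu0) using 1
    simp only [id]; ring
  have hcont : ContinuousOn
      (fun u => Real.exp (-x * (s - u)) * (γ * (γ - 1) * u ^ (γ - 2))) (uIcc (s / 2) s) := by
    rw [uIcc_of_le (by linarith)]
    refine ContinuousOn.mul (Continuous.continuousOn (by fun_prop))
      (continuousOn_const.mul ((continuousOn_rpow_Ioi _).mono fun u hu => ?_))
    exact hm.trans_le hu.1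
  have hftc := intervalIntegral.integral_eq_sub_of_hasDerivAt hd hcont.intervalIntegrable
  have hint : |∫ u in s / 2..s, Real.exp (-x * (s - u)) * (γ * (γ - 1) * u ^ (γ - 2))|
      ≤ (2 * s / (1 + x * s)) * (|γ * (γ - 1)| * 2 ^ |γ - 2| * s ^ (γ - 2)) := by
    have : ‖∫ u in s / 2..s, Real.exp (-x * (s - u)) * (γ * (γ - 1) * u ^ (γ - 2))‖
        ≤ ∫ u in s / 2..s, Real.exp (-x * (s - u)) *
            (|γ * (γ - 1)| * 2 ^ |γ - 2| * s ^ (γ - 2)) := by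
      refine intervalIntegral.norm_integral_le_of_norm_le (by linarith) (ae_of_all _ fun u hu => ?_)
        (Continuous.intervalIntegrable (by fun_prop) _ _)
      have hu0 : 0 < u := hm.trans hu.1
      rw [norm_mul, Real.norm_of_nonneg (Real.exp_pos _).le, norm_mul, Real.norm_eq_abs,
        Real.norm_of_nonneg (Real.rpow_nonneg hu0.le _), mul_assoc]
      gcongr
      exact rpow_le_of_half_le _ hs hu.1.le hu.2
    refine this.trans ?_
    rw [intervalIntegral.integral_mul_const]
    have := Real.rpow_nonneg hs.le (γ - 2)
    exact mul_le_mul_of_nonneg_right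
      (integral_exp_neg_mul_sub_le hx (by linarith) (by linarith)) (by positivity)
  have hqm : |expConvRpowDeriv2 γ x (s / 2)|
      ≤ (|γ| + 1 + C) * (2 ^ |γ - 1| * s ^ (γ - 1)) * (1 + x * s) ^ 2 := by
    set m := s / 2
    have hy1 := hy x m hx hm
    have hy0 := expConv_rpow_nonneg (γ := γ) x hm.le
    have hxm : 0 ≤ x * m := by positivity
    have hp := Real.rpow_nonneg hm.le (γ - 1)
    have e1 : m ^ γ = m ^ (γ - 1) * m := by
      rw [← Real.rpow_add_one hm.ne']; congr 1; ring
    have e2 : m ^ (γ + 1) = m ^ (γ - 1) * m * m := by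
      rw [Real.rpow_add_one hm.ne', e1]
    have hy2 : x ^ 2 * expConv x (fun u => u ^ γ) m ≤ C * m ^ (γ - 1) * (x * m) ^ 2 := by
      have : C * (m ^ (γ + 1) / (1 + x * m)) ≤ C * m ^ (γ + 1) := by
        refine mul_le_mul_of_nonneg_left (div_le_self (Real.rpow_nonneg hm.le _) (by linarith)) hC
      calc _ ≤ x ^ 2 * (C * m ^ (γ + 1)) :=
            mul_le_mul_of_nonneg_left (hy1.trans this) (sq_nonneg x)
        _ = _ := by rw [e2]; ring
    calc |expConvRpowDeriv2 γ x m|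
        ≤ |γ| * m ^ (γ - 1) + m ^ (γ - 1) * (x * m) + C * m ^ (γ - 1) * (x * m) ^ 2 := by
          rw [expConvRpowDeriv2]
          refine (abs_add_le _ _).trans (add_le_add ((abs_sub _ _).trans (add_le_add ?_ ?_)) ?_)
          · rw [abs_mul, abs_of_nonneg hp]
          · rw [abs_of_nonneg (mul_nonneg hx (Real.rpow_nonneg hm.le _)), e1]
            exact le_of_eq (by ring)
          · rwa [abs_of_nonneg (by positivity)]
      _ ≤ (|γ| + 1 + C) * m ^ (γ - 1) * (1 + x * m) ^ 2 := by
          have h1 : (1 : ℝ) ≤ (1 + x * m) ^ 2 := one_le_pow₀ (by linarith)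
          have h2 : x * m ≤ (1 + x * m) ^ 2 := by nlinarith
          have h3 : (x * m) ^ 2 ≤ (1 + x * m) ^ 2 := by nlinarith
          have := mul_le_mul_of_nonneg_left h1 (mul_nonneg (abs_nonneg γ) hp)
          have := mul_le_mul_of_nonneg_left h2 hp
          have := mul_le_mul_of_nonneg_left h3 (mul_nonneg hC hp)
          nlinarith
      _ ≤ _ := by
          have h1 := rpow_le_of_half_le (γ - 1) hs le_rfl (by linarith : s / 2 ≤ s)
          have h2 : x * m ≤ x * s := mul_le_mul_of_nonneg_left (by simp only [m]; linarith) hx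
          gcongr
  have hfin : expConvRpowDeriv2 γ x s
      = (∫ u in s / 2..s, Real.exp (-x * (s - u)) * (γ * (γ - 1) * u ^ (γ - 2)))
        + Real.exp (-(x * s / 2)) * expConvRpowDeriv2 γ x (s / 2) := by
    rw [hftc]
    simp only [sub_self, mul_zero, Real.exp_zero, one_mul]
    rw [show -x * (s - s / 2) = -(x * s / 2) by ring]
    ring
  rw [hfin]
  have e1 : s ^ (γ - 1) = s ^ (γ - 2) * s := by
    rw [← Real.rpow_add_one hs.ne']; congr 1; ring
  have h4 : |Real.exp (-(x * s / 2)) * expConvRpowDeriv2 γ x (s / 2)|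
      ≤ (|γ| + 1 + C) * (2 ^ |γ - 1| * s ^ (γ - 1)) * (216 / (1 + x * s)) := by
    rw [abs_mul, abs_of_pos (Real.exp_pos _)]
    have hp := Real.rpow_nonneg hs.le (γ - 1)
    calc _ ≤ Real.exp (-(x * s / 2)) *
          ((|γ| + 1 + C) * (2 ^ |γ - 1| * s ^ (γ - 1)) * (1 + x * s) ^ 2) := by gcongr
      _ = (|γ| + 1 + C) * (2 ^ |γ - 1| * s ^ (γ - 1)) *
          (Real.exp (-(x * s / 2)) * (1 + x * s) ^ 2) := by ring
      _ ≤ _ := by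
          refine mul_le_mul_of_nonneg_left (exp_neg_half_mul_sq_le hx0) (by positivity)
  refine (abs_add_le _ _).trans ((add_le_add hint h4).trans (le_of_eq ?_))
  rw [e1]; ring

/-- Integration by parts writes the defect as `-∫_a^b (s - a) y''(s) ds`. The constant must not
degenerate as `a → 0`, where `s^{γ-1}` may fail to be integrable; the factor `s - a` is used to
restore `s^γ`. -/
theorem abs_eulerDefect_rpow_le (hγ : -1 < γ) : ∃ C : ℝ, 0 ≤ C ∧ ∀ x a b : ℝ, 0 ≤ x → 0 < a →
    a < b → |eulerDefect x (fun u => u ^ γ) a b| / (1 + x * (b - a))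
      ≤ C * ((b - a) ^ 2 * b ^ (γ - 1)) / (1 + x * b) := by
  obtain ⟨C, hC, hq⟩ := abs_expConvRpowDeriv2_le hγ
  have hγ' : 0 < γ + 1 := by linarith
  refine ⟨C * (1 + 1 / (γ + 1)), by positivity, fun x a b hx ha hab => ?_⟩
  have hb := ha.trans hab
  have hba : 0 < b - a := by linarith
  have hd : ∀ s ∈ uIcc a b, HasDerivAt (fun s => expConv x (fun u => u ^ γ) s
      - expConv x (fun u => u ^ γ) a - (s - a) * (s ^ γ - x * expConv x (fun u => u ^ γ) s))
      (-((s - a) * expConvRpowDeriv2 γ x s)) s := by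
    intro s hs
    rw [uIcc_of_le hab.le] at hs
    have hs0 : 0 < s := ha.trans_le hs.1
    have h1 := (hasDerivAt_expConv_rpow hγ x hs0).sub_const (expConv x (fun u => u ^ γ) a)
    have h2 := ((hasDerivAt_id s).sub_const a).mul (hasDerivAt_rpow_sub_expConv hγ x hs0)
    convert! h1.sub h2 using 1
    simp only [id]; ring
  have hcq : ContinuousOn (fun s => -((s - a) * expConvRpowDeriv2 γ x s)) (uIcc a b) := by
    intro s hs
    rw [uIcc_of_le hab.le] at hs
    have := (hasDerivAt_expConvRpowDeriv2 hγ x (ha.trans_le hs.1)).continuousAt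
    exact (((continuousAt_id.sub continuousAt_const).mul this).neg).continuousWithinAt
  have hftc := intervalIntegral.integral_eq_sub_of_hasDerivAt hd hcq.intervalIntegrable
  have hD : eulerDefect x (fun u => u ^ γ) a b
      = ∫ s in a..b, -((s - a) * expConvRpowDeriv2 γ x s) := by
    rw [hftc, eulerDefect]; simp
  have hk : ‖∫ s in a..b, -((s - a) * expConvRpowDeriv2 γ x s)‖
      ≤ ∫ s in a..b, C * (((b - a) / b) * ((1 + x * (b - a)) / (1 + x * b))) * s ^ γ := by
    refine intervalIntegral.norm_integral_le_of_norm_le hab.le (ae_of_all _ fun s hs => ?_)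
      ((intervalIntegral.intervalIntegrable_rpow' hγ).const_mul _)
    have hs0 : 0 < s := ha.trans hs.1
    have hsa : 0 < s - a := by linarith [hs.1]
    rw [norm_neg, norm_mul, Real.norm_of_nonneg hsa.le, Real.norm_eq_abs]
    have e1 : s ^ γ = s ^ (γ - 1) * s := by
      rw [← Real.rpow_add_one hs0.ne']; congr 1; ring
    have hp := Real.rpow_nonneg hs0.le (γ - 1)
    calc (s - a) * |expConvRpowDeriv2 γ x s| ≤ (s - a) * (C * (s ^ (γ - 1) / (1 + x * s))) :=
          mul_le_mul_of_nonneg_left (hq x s hx hs0) hsa.le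
      _ = C * s ^ (γ - 1) * ((s - a) * (1 / (1 + x * s))) := by ring
      _ ≤ C * s ^ (γ - 1) * (((b - a) / b * s) * ((1 + x * (b - a)) / (1 + x * b))) := by
          -- Trades `s - a` for a multiple of `s`, turning `s^{γ-1}` into the integrable `s^γ`.
          have h1 : s - a ≤ (b - a) / b * s := by
            rw [div_mul_eq_mul_div, le_div_iff₀ hb]
            nlinarith [hs.2]
          -- Holds since `(1 + xs)(1 + x(b - a)) ≥ 1 + x(s + b - a) ≥ 1 + xb`. The factor `1 + x(b -
          -- a)` lost here is repaid by the amplification factor of the step.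
          have h2 : 1 / (1 + x * s) ≤ (1 + x * (b - a)) / (1 + x * b) := by
            rw [div_le_div_iff₀ (by positivity) (by positivity)]
            have : 0 ≤ x * (s - a) := by positivity
            have : 0 ≤ x * (b - a) * (x * s) := by positivity
            nlinarith
          have : 0 ≤ (b - a) / b * s := by positivity
          gcongr
      _ = _ := by rw [e1]; ring
  rw [intervalIntegral.integral_const_mul] at hk
  have hx1 : 0 < 1 + x * (b - a) := by positivity
  have hx2 : 0 < 1 + x * b := by positivity
  rw [div_le_iff₀ hx1, hD]
  refine hk.trans ((mul_le_mul_of_nonneg_left (integral_rpow_le_mul hγ ha hab.le)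
    (by positivity)).trans (le_of_eq ?_))
  have e1 : b ^ γ = b ^ (γ - 1) * b := by
    rw [← Real.rpow_add_one hb.ne']; congr 1; ring
  rw [e1]
  field_simp

/-- From `a = 0` the defect is `(1 + xb) y(b) - b^{γ+1}`, and both terms are of order `b^{γ+1}`, so
the singularity of `y''` at the origin never enters. -/
theorem abs_eulerDefect_zero_rpow_le (hγ : -1 < γ) : ∃ C : ℝ, 0 ≤ C ∧ ∀ x b : ℝ, 0 ≤ x → 0 < b →
    |eulerDefect x (fun u => u ^ γ) 0 b| / (1 + x * b) ≤ C * b ^ (γ + 1) / (1 + x * b) := by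
  obtain ⟨C, hC, hy⟩ := expConv_rpow_le hγ
  refine ⟨C + 1, by positivity, fun x b hx hb => ?_⟩
  have hxb : 0 ≤ x * b := by positivity
  refine div_le_div_of_nonneg_right ?_ (by positivity)
  have h0 := expConv_rpow_nonneg (γ := γ) x hb.le
  have h1 := hy x b hx hb
  have hp := Real.rpow_nonneg hb.le γ
  have e0 : expConv x (fun u : ℝ => u ^ γ) 0 = 0 := by simp [expConv]
  have e1 : b ^ (γ + 1) = b ^ γ * b := Real.rpow_add_one hb.ne' _
  have e2 : eulerDefect x (fun u => u ^ γ) 0 b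
      = (1 + x * b) * expConv x (fun u => u ^ γ) b - b ^ (γ + 1) := by
    rw [eulerDefect, e0, e1, smul_eq_mul, smul_eq_mul]; ring
  have h2 : (1 + x * b) * expConv x (fun u => u ^ γ) b ≤ C * b ^ (γ + 1) := by
    rw [← mul_div_assoc, le_div_iff₀ (by positivity)] at h1
    linarith
  have h3 := Real.rpow_nonneg hb.le (γ + 1)
  rw [e2, abs_le]
  constructor <;> nlinarith [mul_nonneg (by positivity : 0 ≤ 1 + x * b) h0, mul_nonneg hC h3]

end Power

/-! ### Euler defect for the primitive of a Lipschitz function -/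

section Smooth

variable {X : Type*} [NormedAddCommGroup X] [NormedSpace ℝ X]

/-- Differentiating `y' = -x y + f` shows that `y'` solves the same equation with source `f' = h`,
and `y'` vanishes at `0`; an integrating factor makes this precise. -/
theorem sub_smul_expConv_primitive [CompleteSpace X] {h : ℝ → X} (hc : Continuous h) (x s : ℝ) :
    (∫ u in (0 : ℝ)..s, h u) - x • expConv x (fun v => ∫ u in (0 : ℝ)..v, h u) s
      = expConv x h s := by
  set f : ℝ → X := fun v => ∫ u in (0 : ℝ)..v, h u with hf
  have hfd : ∀ v, HasDerivAt f (h v) v := fun v => hc.integral_hasStrictDerivAt 0 v |>.hasDerivAt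
  have hfc : Continuous f := continuous_iff_continuousAt.2 fun v => (hfd v).continuousAt
  have hd : ∀ v ∈ uIcc 0 s, HasDerivAt (fun v => Real.exp (x * v) • (f v - x • expConv x f v))
      (Real.exp (x * v) • h v) v := fun v _ => by
    have h1 := ((hasDerivAt_id v).const_mul x).exp
    have h2 := (hfd v).sub
      ((hasDerivAt_expConv x (hfc.intervalIntegrable 0 v) isOpen_univ hfc.continuousOn
        (mem_univ v)).const_smul x)
    convert! h1.smul h2 using 1
    simp only [id, Pi.sub_apply, Pi.smul_apply]
    module
  have := intervalIntegral.integral_eq_sub_of_hasDerivAt hd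
    (Continuous.intervalIntegrable (by fun_prop) _ _)
  have e0 : f 0 - x • expConv x f 0 = 0 := by simp [hf, expConv]
  rw [e0, smul_zero, sub_zero] at this
  rw [expConv_eq_exp_smul x h, this, smul_smul, ← Real.exp_add,
    show -x * s + x * s = 0 by ring, Real.exp_zero, one_smul]

/-- As `h` vanishes on the negative axis, the convolution at `s` equals the one at `b` with `h`
delayed by `b - s`. Both then carry the same kernel, and the Lipschitz bound is applied under the
integral. -/
theorem norm_expConv_sub_le {h : ℝ → X} (hc : Continuous h) (h0 : ∀ u ≤ 0, h u = 0)
    {b L : ℝ} (hL : ∀ s s' : ℝ, s ≤ s' → s' ≤ b → ‖h s' - h s‖ ≤ L * (s' - s))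
    {x s : ℝ} (hx : 0 ≤ x) (hs : 0 ≤ s) (hsb : s ≤ b) :
    ‖expConv x h b - expConv x h s‖ ≤ L * (b - s) * (2 * b / (1 + x * b)) := by
  have e1 : expConv x h s
      = ∫ u in (0 : ℝ)..b, Real.exp (-x * (b - u)) • h (u - (b - s)) := by
    have hi : ∀ c d : ℝ, IntervalIntegrable
        (fun u => Real.exp (-x * (b - u)) • h (u - (b - s))) volume c d := fun c d =>
      Continuous.intervalIntegrable (by fun_prop) _ _
    rw [← intervalIntegral.integral_add_adjacent_intervals (hi 0 (b - s)) (hi (b - s) b)]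
    have z : ∫ u in (0 : ℝ)..(b - s), Real.exp (-x * (b - u)) • h (u - (b - s)) = 0 := by
      rw [intervalIntegral.integral_congr (g := fun _ => (0 : X)), intervalIntegral.integral_zero]
      intro u hu
      rw [uIcc_of_le (by linarith)] at hu
      simp only
      rw [h0 _ (by linarith [hu.2]), smul_zero]
    rw [z, zero_add, expConv]
    have := intervalIntegral.integral_comp_sub_right (a := b - s) (b := b)
      (fun u => Real.exp (-x * (s - u)) • h u) (b - s)
    rw [sub_self, sub_sub_cancel] at this
    rw [← this]
    congr 1
    funext u
    congr 3
    ring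
  rw [e1, expConv, ← intervalIntegral.integral_sub (Continuous.intervalIntegrable (by fun_prop) _ _)
    (Continuous.intervalIntegrable (by fun_prop) _ _)]
  have hb := hs.trans hsb
  refine (intervalIntegral.norm_integral_le_of_norm_le
    (g := fun u => L * (b - s) * Real.exp (-x * (b - u))) hb (ae_of_all _ fun u hu => ?_)
    (Continuous.intervalIntegrable (by fun_prop) _ _)).trans ?_
  · rw [← smul_sub, norm_smul, Real.norm_of_nonneg (Real.exp_pos _).le, mul_comm]
    refine mul_le_mul_of_nonneg_right ?_ (Real.exp_pos _).le
    have := hL (u - (b - s)) u (by linarith) hu.2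
    rwa [sub_sub_cancel] at this
  · rw [intervalIntegral.integral_const_mul]
    refine mul_le_mul_of_nonneg_left (integral_exp_neg_mul_sub_le hx le_rfl hb) ?_
    exact (norm_nonneg _).trans (hL s b hsb le_rfl)

theorem norm_eulerDefect_primitive_le [CompleteSpace X] {h : ℝ → X} (hc : Continuous h)
    (h0 : ∀ u ≤ 0, h u = 0)
    {a b L : ℝ} (hL : ∀ s s' : ℝ, s ≤ s' → s' ≤ b → ‖h s' - h s‖ ≤ L * (s' - s)) (hL0 : 0 ≤ L)
    {x : ℝ} (hx : 0 ≤ x) (ha : 0 ≤ a) (hab : a ≤ b) :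
    ‖eulerDefect x (fun v => ∫ u in (0 : ℝ)..v, h u) a b‖
      ≤ (b - a) ^ 2 * L * (2 * b / (1 + x * b)) := by
  set f : ℝ → X := fun v => ∫ u in (0 : ℝ)..v, h u with hf
  have hb := ha.trans hab
  have hfc : Continuous f := continuous_iff_continuousAt.2 fun v =>
    (hc.integral_hasStrictDerivAt 0 v).hasDerivAt.continuousAt
  have hyd : ∀ v, HasDerivAt (expConv x f) (expConv x h v) v := fun v => by
    have := hasDerivAt_expConv x (hfc.intervalIntegrable 0 v) isOpen_univ hfc.continuousOn
        (mem_univ v)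
    rwa [hf, sub_smul_expConv_primitive hc] at this
  have hzc : Continuous (expConv x h) := continuous_iff_continuousAt.2 fun v =>
    (hasDerivAt_expConv x (hc.intervalIntegrable 0 v) isOpen_univ hc.continuousOn
        (mem_univ v)).continuousAt
  -- The derivative of the solution is `expConv x h`, so the defect integrates its deviation from
  -- the right endpoint value.
  have e : eulerDefect x f a b = ∫ s in a..b, (expConv x h s - expConv x h b) := by
    rw [intervalIntegral.integral_sub (hzc.intervalIntegrable _ _) (by simp),
      intervalIntegral.integral_eq_sub_of_hasDerivAt (fun v _ => hyd v)
        (hzc.intervalIntegrable _ _), intervalIntegral.integral_const, eulerDefect, hf,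
      sub_smul_expConv_primitive hc]
  rw [e]
  have := intervalIntegral.norm_integral_le_of_norm_le_const (a := a) (b := b)
    (f := fun s => expConv x h s - expConv x h b)
    (C := L * (b - a) * (2 * b / (1 + x * b))) fun s hs => by
      rw [uIoc_of_le hab] at hs
      rw [norm_sub_rev]
      refine (norm_expConv_sub_le hc h0 hL hx (ha.trans hs.1.le) hs.2).trans ?_
      have : 0 ≤ 2 * b / (1 + x * b) := by positivity
      have := hs.1.le
      gcongr
  refine this.trans (le_of_eq ?_)
  rw [abs_of_nonneg (by linarith)]; ring

end Smooth

/-! ### Truncated powers and the Taylor remainder -/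

/-- The truncated power `r_+^δ`. -/
def truncPow (δ r : ℝ) : ℝ := max r 0 ^ δ

section TruncPow

variable {δ : ℝ}

theorem continuous_truncPow (hδ : 0 ≤ δ) : Continuous (truncPow δ) :=
  (continuous_id.max continuous_const).rpow_const fun _ => Or.inr hδ

theorem truncPow_nonneg (r : ℝ) : 0 ≤ truncPow δ r := Real.rpow_nonneg (le_max_right _ _) _

theorem truncPow_of_nonneg {r : ℝ} (hr : 0 ≤ r) : truncPow δ r = r ^ δ := by
  rw [truncPow, max_eq_left hr]

theorem truncPow_of_nonpos (hδ : 0 < δ) {r : ℝ} (hr : r ≤ 0) : truncPow δ r = 0 := by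
  rw [truncPow, max_eq_right hr, Real.zero_rpow hδ.ne']

theorem monotone_truncPow (hδ : 0 ≤ δ) : Monotone (truncPow δ) := fun _ _ h =>
  Real.rpow_le_rpow (le_max_right _ _) (max_le_max_right _ h) hδ

theorem truncPow_sub_le (hδ : 1 ≤ δ) {s s' b : ℝ} (hs : s ≤ s') (hb : s' ≤ b) (hb0 : 0 ≤ b) :
    truncPow δ s' - truncPow δ s ≤ δ * b ^ (δ - 1) * (s' - s) := by
  have hp : 0 ≤ δ * b ^ (δ - 1) := mul_nonneg (by linarith) (Real.rpow_nonneg hb0 _)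
  rcases le_or_gt s' 0 with h | h
  · rw [truncPow_of_nonpos (by linarith) h, truncPow_of_nonpos (by linarith) (hs.trans h), sub_self]
    exact mul_nonneg hp (by linarith)
  · set r := max s 0
    have hr0 : 0 ≤ r := le_max_right _ _
    have hr : r ≤ s' := max_le hs h.le
    -- Bernoulli's inequality, as the tangent line bound for `r ↦ r^δ` at `s'`.
    have h1 := one_add_mul_self_le_rpow_one_add (s := r / s' - 1)
      (by linarith [div_nonneg hr0 h.le]) hδ
    rw [add_sub_cancel, Real.div_rpow hr0 h.le, le_div_iff₀ (Real.rpow_pos_of_pos h _)] at h1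
    have e : s' ^ δ = s' ^ (δ - 1) * s' := by
      rw [← Real.rpow_add_one h.ne']; congr 1; ring
    have e2 : (1 + δ * (r / s' - 1)) * s' ^ δ = s' ^ δ + δ * s' ^ (δ - 1) * (r - s') := by
      rw [e]; field_simp
    rw [e2] at h1
    have h2 : s' ^ (δ - 1) ≤ b ^ (δ - 1) := Real.rpow_le_rpow h.le hb (by linarith)
    have h3 : s' - r ≤ s' - s := by linarith [le_max_left s 0]
    have h4 : δ * s' ^ (δ - 1) * (s' - r) ≤ δ * b ^ (δ - 1) * (s' - s) :=
      mul_le_mul (mul_le_mul_of_nonneg_left h2 (by linarith)) h3 (by linarith) hp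
    rw [truncPow_of_nonneg h.le, truncPow]
    linarith

theorem integral_zero_truncPow (hδ : 0 < δ) (b : ℝ) :
    ∫ r in (0 : ℝ)..b, truncPow δ r = truncPow (δ + 1) b / (δ + 1) := by
  rcases le_or_gt 0 b with h | h
  · rw [truncPow_of_nonneg h, intervalIntegral.integral_congr (g := fun r => r ^ δ),
      integral_rpow (Or.inl (by linarith)), Real.zero_rpow (by linarith), sub_zero]
    intro r hr
    rw [uIcc_of_le h] at hr
    exact truncPow_of_nonneg hr.1
  · rw [truncPow_of_nonpos (by linarith) h.le,
      intervalIntegral.integral_congr (g := fun _ => (0 : ℝ))]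
    · simp
    intro r hr
    rw [uIcc_of_ge h.le] at hr
    exact truncPow_of_nonpos hδ hr.2

theorem integral_truncPow (hδ : 0 < δ) (a b : ℝ) :
    ∫ r in a..b, truncPow δ r = (truncPow (δ + 1) b - truncPow (δ + 1) a) / (δ + 1) := by
  have hi := fun a b => (continuous_truncPow hδ.le).intervalIntegrable (μ := volume) a b
  rw [← intervalIntegral.integral_interval_sub_left (hi 0 b) (hi 0 a), integral_zero_truncPow hδ,
    integral_zero_truncPow hδ, sub_div]

end TruncPow

section Remainder

variable {X : Type*} [NormedAddCommGroup X] [NormedSpace ℝ X] {δ T B : ℝ} {g : ℝ → X}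

/-- The convolution `∫_0^T (s - u)_+^δ g(u) du`. -/
def truncConv (δ T : ℝ) (g : ℝ → X) (s : ℝ) : X :=
  ∫ u in (0 : ℝ)..T, truncPow δ (s - u) • g u

theorem truncConv_of_nonpos (hδ : 0 < δ) (hT : 0 ≤ T) {s : ℝ} (hs : s ≤ 0) :
    truncConv δ T g s = 0 := by
  rw [truncConv, intervalIntegral.integral_congr (g := fun _ => (0 : X)),
    intervalIntegral.integral_zero]
  intro u hu
  rw [uIcc_of_le hT] at hu
  simp only
  rw [truncPow_of_nonpos hδ (by linarith [hu.1]), zero_smul]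

theorem intervalIntegrable_of_bounded {X : Type*} [NormedAddCommGroup X] {T B : ℝ} {g : ℝ → X}
    (hT : 0 ≤ T) (hg : AEStronglyMeasurable g (volume.restrict (Ioc 0 T)))
    (hB : ∀ u ∈ Ioc 0 T, ‖g u‖ ≤ B) : IntervalIntegrable g volume 0 T := by
  rw [intervalIntegrable_iff_integrableOn_Ioc_of_le hT]
  exact Integrable.of_bound hg B ((ae_restrict_iff' measurableSet_Ioc).2 (ae_of_all _ hB))

theorem intervalIntegrable_truncPow_smul (hδ : 0 ≤ δ) (hg : IntervalIntegrable g volume 0 T)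
    (s : ℝ) : IntervalIntegrable (fun u => truncPow δ (s - u) • g u) volume 0 T :=
  hg.continuousOn_smul ((continuous_truncPow hδ).comp (by fun_prop)).continuousOn

theorem truncConv_eq_integral (hδ : 0 < δ) (hg : IntervalIntegrable g volume 0 T) {s : ℝ}
    (hs : 0 ≤ s) (hsT : s ≤ T) :
    truncConv δ T g s = ∫ u in (0 : ℝ)..s, (s - u) ^ δ • g u := by
  have hi := intervalIntegrable_truncPow_smul hδ.le hg s
  have h1 : uIcc 0 s ⊆ uIcc 0 T := by
    rw [uIcc_of_le hs, uIcc_of_le (hs.trans hsT)]; exact Icc_subset_Icc_right hsT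
  have h2 : uIcc s T ⊆ uIcc 0 T := by
    rw [uIcc_of_le hsT, uIcc_of_le (hs.trans hsT)]; exact Icc_subset_Icc_left hs
  rw [truncConv, ← intervalIntegral.integral_add_adjacent_intervals (hi.mono_set h1)
    (hi.mono_set h2), intervalIntegral.integral_congr (a := s) (g := fun _ => (0 : X)),
    intervalIntegral.integral_zero, add_zero]
  · refine intervalIntegral.integral_congr fun u hu => ?_
    rw [uIcc_of_le hs] at hu
    rw [truncPow_of_nonneg (by linarith [hu.2])]
  · intro u hu
    rw [uIcc_of_le hsT] at hu
    simp only
    rw [truncPow_of_nonpos hδ (by linarith [hu.1]), zero_smul]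

theorem continuous_truncConv (hδ : 0 < δ) (hT : 0 ≤ T)
    (hg : IntervalIntegrable g volume 0 T) : Continuous (truncConv δ T g) := by
  refine continuous_iff_continuousAt.2 fun s => ?_
  refine intervalIntegral.continuousAt_of_dominated_interval
    (bound := fun u => truncPow δ (s + 1) * ‖g u‖) ?_ ?_ (hg.norm.const_mul _) ?_
  · exact Eventually.of_forall fun s' =>
      (intervalIntegrable_truncPow_smul hδ.le hg s').aestronglyMeasurable_restrict_uIoc
  · filter_upwards [Iio_mem_nhds (show s < s + 1 by linarith)] with s' hs'
    refine ae_of_all _ fun u hu => ?_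
    rw [uIoc_of_le hT] at hu
    rw [norm_smul, Real.norm_of_nonneg (truncPow_nonneg _)]
    have : s' - u ≤ s + 1 := by linarith [hu.1, mem_Iio.1 hs']
    exact mul_le_mul_of_nonneg_right (monotone_truncPow hδ.le this) (norm_nonneg _)
  · refine ae_of_all _ fun u _ => ?_
    exact (((continuous_truncPow hδ.le).comp (by fun_prop)).smul continuous_const).continuousAt

/-- By monotonicity of the kernel, the increment is at most `S` times the increment of `∫ (s -
u)_+^δ du`, a truncated power of order `δ + 1`. For `u > b` both kernels vanish, so only the bound
for `g` on `(0, b]` enters. -/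
theorem norm_truncConv_sub_le (hδ : 0 < δ) (hT : 0 ≤ T)
    (hg : IntervalIntegrable g volume 0 T) {b S : ℝ} (hb : 0 ≤ b) (hbT : b ≤ T) (hS0 : 0 ≤ S)
    (hS : ∀ u ∈ Ioc 0 b, ‖g u‖ ≤ S) {s s' : ℝ} (hs : s ≤ s') (hsb : s' ≤ b) :
    ‖truncConv δ T g s' - truncConv δ T g s‖ ≤ S * b ^ δ * (s' - s) := by
  have hi := fun s => intervalIntegrable_truncPow_smul hδ.le hg s
  have hc : ∀ s, Continuous fun u => truncPow δ (s - u) := fun s =>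
    (continuous_truncPow hδ.le).comp (by fun_prop)
  have hval : ∀ s ≤ T, ∫ u in (0 : ℝ)..T, truncPow δ (s - u) = truncPow (δ + 1) s / (δ + 1) := by
    intro s hs
    rw [intervalIntegral.integral_comp_sub_left (fun r => truncPow δ r) s, integral_truncPow hδ,
      sub_zero, truncPow_of_nonpos (by linarith) (by linarith : s - T ≤ 0), sub_zero]
  rw [truncConv, truncConv, ← intervalIntegral.integral_sub (hi s') (hi s)]
  refine (intervalIntegral.norm_integral_le_of_norm_le
    (g := fun u => S * (truncPow δ (s' - u) - truncPow δ (s - u))) hT (ae_of_all _ fun u hu => ?_)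
    ((((hc s').sub (hc s)).const_mul S).intervalIntegrable _ _)).trans ?_
  · have hm := monotone_truncPow hδ.le (show s - u ≤ s' - u by linarith)
    rw [← sub_smul, norm_smul, Real.norm_of_nonneg (by linarith), mul_comm]
    rcases le_or_gt u b with h | h
    · exact mul_le_mul_of_nonneg_right (hS u ⟨hu.1, h⟩) (by linarith)
    · rw [truncPow_of_nonpos hδ (by linarith : s' - u ≤ 0),
        truncPow_of_nonpos hδ (by linarith : s - u ≤ 0)]
      simp
  · rw [intervalIntegral.integral_const_mul, intervalIntegral.integral_sub
      ((hc s').intervalIntegrable _ _) ((hc s).intervalIntegrable _ _), hval s' (by linarith),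
      hval s (by linarith), ← sub_div, mul_assoc]
    refine mul_le_mul_of_nonneg_left ?_ hS0
    rw [div_le_iff₀ (by linarith)]
    have := truncPow_sub_le (δ := δ + 1) (by linarith) hs hsb hb
    rw [add_sub_cancel_right] at this
    linarith

/-- Fubini: integrating in `v` raises the order of the kernel by one. This is what exhibits the
Taylor remainder as a primitive. -/
theorem integral_truncConv [CompleteSpace X] (hδ : 0 < δ) (hT : 0 ≤ T)
    (hg : IntervalIntegrable g volume 0 T) {s : ℝ} (hs : 0 ≤ s) :
    ∫ v in (0 : ℝ)..s, truncConv δ T g v = (1 / (δ + 1)) • truncConv (δ + 1) T g s := by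
  have hgi := (intervalIntegrable_iff_integrableOn_Ioc_of_le hT).1 hg
  have hint : Integrable (Function.uncurry fun v u => truncPow δ (v - u) • g u)
      ((volume.restrict (Ioc 0 s)).prod (volume.restrict (Ioc 0 T))) := by
    have h1 : Integrable (fun p : ℝ × ℝ => g p.2)
        ((volume.restrict (Ioc 0 s)).prod (volume.restrict (Ioc 0 T))) :=
      Integrable.comp_snd hgi _
    have hcont : Continuous fun p : ℝ × ℝ => truncPow δ (p.1 - p.2) :=
      (continuous_truncPow hδ.le).comp (by fun_prop)
    refine h1.bdd_smul (s ^ δ) hcont.aestronglyMeasurable ?_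
    have : ∀ᵐ p : ℝ × ℝ ∂((volume.restrict (Ioc 0 s)).prod (volume.restrict (Ioc 0 T))),
        p ∈ Ioc 0 s ×ˢ Ioc 0 T := by
      rw [Measure.prod_restrict]
      exact ae_restrict_mem (measurableSet_Ioc.prod measurableSet_Ioc)
    filter_upwards [this] with p hp
    rw [Real.norm_of_nonneg (truncPow_nonneg _), ← truncPow_of_nonneg hs]
    exact monotone_truncPow hδ.le (by linarith [hp.1.2, hp.2.1])
  simp only [truncConv, intervalIntegral.integral_of_le hs, intervalIntegral.integral_of_le hT]
  rw [integral_integral_swap hint, ← integral_smul]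
  refine setIntegral_congr_fun measurableSet_Ioc fun u hu => ?_
  rw [integral_smul_const, ← intervalIntegral.integral_of_le hs,
    intervalIntegral.integral_comp_sub_right (fun r => truncPow δ r) u, integral_truncPow hδ,
    truncPow_of_nonpos (by linarith) (by linarith [hu.1] : 0 - u ≤ 0), sub_zero, smul_smul]
  congr 1
  ring

end Remainder

/-! ### Boundary values of the symbol and the keyhole contour -/

section ExtendFrom

variable {E : Type*} [NormedAddCommGroup E] [NormedSpace ℂ E] {α M : ℝ} {K : ℂ → E} {A : Set ℂ}

theorem extendFrom_eq_self_of_mem_slitPlane (hK : SectorialSymbol α M K) {z : ℂ}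
    (hz : z ∈ closure A) (hz' : z ∈ Complex.slitPlane) : extendFrom A K z = K z :=
  extendFrom_eq hz
    ((hK.holomorphic.differentiableAt
      (Complex.isOpen_slitPlane.mem_nhds hz')).continuousAt.continuousWithinAt)

theorem norm_extendFrom_le (hK : SectorialSymbol α M K) (hA : A ⊆ Complex.slitPlane)
    (hc : ContinuousOn (extendFrom A K) (closure A \ {0})) {z : ℂ} (hz : z ∈ closure A)
    (hz0 : z ≠ 0) : ‖extendFrom A K z‖ ≤ M * ‖z‖ ^ (-α) := by
  have hA' : A ⊆ closure A \ {0} := fun w hw =>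
    ⟨subset_closure hw, Complex.slitPlane_ne_zero (hA hw)⟩
  have h1 : Tendsto (fun w => ‖extendFrom A K w‖) (𝓝[A] z) (𝓝 ‖extendFrom A K z‖) :=
    ((hc z ⟨hz, hz0⟩).mono hA').norm
  have h2 : Tendsto (fun w : ℂ => M * ‖w‖ ^ (-α)) (𝓝[A] z) (𝓝 (M * ‖z‖ ^ (-α))) :=
    ((continuous_norm.continuousAt.tendsto.mono_left nhdsWithin_le_nhds).rpow_const
      (Or.inl (norm_ne_zero_iff.2 hz0))).const_mul M
  have := mem_closure_iff_nhdsWithin_neBot.1 hz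
  refine le_of_tendsto_of_tendsto h1 h2 ?_
  filter_upwards [self_mem_nhdsWithin] with w hw
  rw [extendFrom_eq_self_of_mem_slitPlane hK (subset_closure hw) (hA hw)]
  exact hK.bound w (hA hw)

end ExtendFrom

section Symbol

variable {E : Type*} [NormedAddCommGroup E] [NormedSpace ℂ E] {α M : ℝ} {K : ℂ → E}

theorem upperExt_eq (hK : SectorialSymbol α M K) {z : ℂ} (hz : 0 ≤ z.im)
    (hz' : z ∈ Complex.slitPlane) : upperExt K z = K z :=
  extendFrom_eq_self_of_mem_slitPlane hK (by rw [Complex.closure_setOfPred_lt_im]; exact hz) hz'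

theorem lowerExt_eq (hK : SectorialSymbol α M K) {z : ℂ} (hz : z.im ≤ 0)
    (hz' : z ∈ Complex.slitPlane) : lowerExt K z = K z :=
  extendFrom_eq_self_of_mem_slitPlane hK (by rw [Complex.closure_setOfPred_im_lt]; exact hz) hz'

theorem norm_upperExt_le (hK : SectorialSymbol α M K) {z : ℂ} (hz : 0 ≤ z.im) (hz0 : z ≠ 0) :
    ‖upperExt K z‖ ≤ M * ‖z‖ ^ (-α) :=
  norm_extendFrom_le (A := {z : ℂ | 0 < z.im}) hK
    (fun _ hw => Complex.mem_slitPlane_iff.2 (Or.inr (ne_of_gt hw)))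
    (by rw [Complex.closure_setOfPred_lt_im]; exact hK.continuous_upper)
    (by rw [Complex.closure_setOfPred_lt_im]; exact hz) hz0

theorem norm_lowerExt_le (hK : SectorialSymbol α M K) {z : ℂ} (hz : z.im ≤ 0) (hz0 : z ≠ 0) :
    ‖lowerExt K z‖ ≤ M * ‖z‖ ^ (-α) :=
  norm_extendFrom_le (A := {z : ℂ | z.im < 0}) hK
    (fun _ hw => Complex.mem_slitPlane_iff.2 (Or.inr (ne_of_lt hw)))
    (by rw [Complex.closure_setOfPred_im_lt]; exact hK.continuous_lower)
    (by rw [Complex.closure_setOfPred_im_lt]; exact hz) hz0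

theorem norm_cutDensity_le (hK : SectorialSymbol α M K) {x : ℝ} (hx : 0 < x) :
    ‖cutDensity K x‖ ≤ M / Real.pi * x ^ (-α) := by
  have hx0 : -(x : ℂ) ≠ 0 := by simpa using hx.ne'
  have h1 := norm_upperExt_le hK (z := -(x : ℂ)) (by simp) hx0
  have h2 := norm_lowerExt_le hK (z := -(x : ℂ)) (by simp) hx0
  rw [norm_neg, Complex.norm_real, Real.norm_of_nonneg hx.le] at h1 h2
  have h3 := (norm_sub_le (lowerExt K (-(x : ℂ))) (upperExt K (-(x : ℂ)))).trans (add_le_add h2 h1)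
  have h4 : ‖(1 / (2 * (Real.pi : ℂ) * Complex.I))‖ = 1 / (2 * Real.pi) := by
    simp [abs_of_pos Real.pi_pos]
  rw [cutDensity, norm_smul, h4]
  have := Real.pi_pos
  calc _ ≤ 1 / (2 * Real.pi) * (M * x ^ (-α) + M * x ^ (-α)) := by gcongr
    _ = _ := by field_simp; ring

theorem continuousOn_cutDensity (hK : SectorialSymbol α M K) :
    ContinuousOn (cutDensity K) (Ioi 0) := by
  have hc : ContinuousOn (fun x : ℝ => -(x : ℂ)) (Ioi 0) :=
    (Complex.continuous_ofReal.neg).continuousOn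
  refine ContinuousOn.const_smul (ContinuousOn.sub ?_ ?_) _
  · exact hK.continuous_lower.comp hc fun x hx => ⟨by simp, by simpa using (ne_of_gt hx)⟩
  · exact hK.continuous_upper.comp hc fun x hx => ⟨by simp, by simpa using (ne_of_gt hx)⟩

/-- The symbol in the logarithmic coordinate, on the closed strip `|Im w| ≤ π`. -/
def logSymbol (K : ℂ → E) (w : ℂ) : E :=
  if 0 ≤ w.im then upperExt K (Complex.exp w) else lowerExt K (Complex.exp w)

theorem exp_mem_slitPlane_of_abs_im_lt {w : ℂ} (hw : |w.im| < Real.pi) :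
    Complex.exp w ∈ Complex.slitPlane := by
  rw [abs_lt] at hw
  rw [Complex.mem_slitPlane_iff_arg]
  refine ⟨?_, Complex.exp_ne_zero w⟩
  rw [← Complex.log_im, Complex.log_exp hw.1 hw.2.le]
  exact hw.2.ne

theorem im_exp_nonneg {w : ℂ} (h0 : 0 ≤ w.im) (h1 : w.im ≤ Real.pi) :
    0 ≤ (Complex.exp w).im := by
  rw [Complex.exp_im]
  exact mul_nonneg (Real.exp_pos _).le (Real.sin_nonneg_of_nonneg_of_le_pi h0 h1)

theorem im_exp_nonpos {w : ℂ} (h0 : w.im ≤ 0) (h1 : -Real.pi ≤ w.im) :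
    (Complex.exp w).im ≤ 0 := by
  rw [Complex.exp_im]
  exact mul_nonpos_of_nonneg_of_nonpos (Real.exp_pos _).le
    (Real.sin_nonpos_of_nonpos_of_neg_pi_le h0 h1)

theorem logSymbol_eq (hK : SectorialSymbol α M K) {w : ℂ} (hw : |w.im| < Real.pi) :
    logSymbol K w = K (Complex.exp w) := by
  have hs := exp_mem_slitPlane_of_abs_im_lt hw
  rw [abs_lt] at hw
  rw [logSymbol]
  split_ifs with h
  · exact upperExt_eq hK (im_exp_nonneg h hw.2.le) hs
  · exact lowerExt_eq hK (im_exp_nonpos (not_le.1 h).le hw.1.le) hs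

theorem norm_logSymbol_le (hK : SectorialSymbol α M K) {w : ℂ} (hw : |w.im| ≤ Real.pi) :
    ‖logSymbol K w‖ ≤ M * Real.exp (-α * w.re) := by
  have e : ‖Complex.exp w‖ ^ (-α) = Real.exp (-α * w.re) := by
    rw [Complex.norm_exp, ← Real.exp_mul, mul_comm]
  rw [abs_le] at hw
  rw [logSymbol, ← e]
  split_ifs with h
  · exact norm_upperExt_le hK (im_exp_nonneg h hw.2) (Complex.exp_ne_zero w)
  · exact norm_lowerExt_le hK (im_exp_nonpos (not_le.1 h).le hw.1) (Complex.exp_ne_zero w)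

theorem isOpen_abs_im_lt (r : ℝ) : IsOpen {w : ℂ | |w.im| < r} :=
  isOpen_lt (continuous_abs.comp Complex.continuous_im) continuous_const

theorem differentiableAt_logSymbol (hK : SectorialSymbol α M K) {w : ℂ} (hw : |w.im| < Real.pi) :
    DifferentiableAt ℂ (logSymbol K) w := by
  have h : DifferentiableAt ℂ (K ∘ Complex.exp) w :=
    DifferentiableAt.comp w (hK.holomorphic.differentiableAt
      (Complex.isOpen_slitPlane.mem_nhds (exp_mem_slitPlane_of_abs_im_lt hw)))
      Complex.differentiableAt_exp
  refine h.congr_of_eventuallyEq ?_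
  filter_upwards [(isOpen_abs_im_lt Real.pi).mem_nhds hw] with v hv using logSymbol_eq hK hv

/-- In the coordinate `w = log z` the two sides of the cut become the separate edges `Im w = ±π`.
Near an edge only one of the two continuations is involved, and in the open strip the function is
holomorphic. -/
theorem continuousOn_logSymbol (hK : SectorialSymbol α M K) :
    ContinuousOn (logSymbol K) {w : ℂ | |w.im| ≤ Real.pi} := by
  intro w hw
  rcases lt_or_eq_of_le (show |w.im| ≤ Real.pi from hw) with h | h
  · exact (differentiableAt_logSymbol hK h).continuousAt.continuousWithinAt
  rcases abs_cases w.im with ⟨h1, h2⟩ | ⟨h1, h2⟩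
  · have hpos : 0 < w.im := by rw [← h1, h]; exact Real.pi_pos
    have hev : ∀ᶠ v in 𝓝 w, 0 < v.im := Complex.continuous_im.continuousAt.eventually_const_lt hpos
    have hc := (hK.continuous_upper (Complex.exp w)
      ⟨im_exp_nonneg h2 (by rw [← h1, h]), Complex.exp_ne_zero w⟩)
    have hcomp : ContinuousWithinAt (upperExt K ∘ Complex.exp)
        ({w : ℂ | |w.im| ≤ Real.pi} ∩ {v | 0 < v.im}) w :=
      hc.comp Complex.continuous_exp.continuousWithinAt fun v hv =>
        ⟨im_exp_nonneg (le_of_lt hv.2) (abs_le.1 hv.1).2, Complex.exp_ne_zero v⟩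
    rw [continuousWithinAt_inter hev] at hcomp
    refine hcomp.congr_of_eventuallyEq ?_ (by simp [logSymbol, h2])
    filter_upwards [nhdsWithin_le_nhds hev] with v hv
    simp [logSymbol, le_of_lt hv]
  · have hev : ∀ᶠ v in 𝓝 w, v.im < 0 := Complex.continuous_im.continuousAt.eventually_lt_const h2
    have hc := (hK.continuous_lower (Complex.exp w)
      ⟨im_exp_nonpos h2.le (by linarith), Complex.exp_ne_zero w⟩)
    have hcomp : ContinuousWithinAt (lowerExt K ∘ Complex.exp)
        ({w : ℂ | |w.im| ≤ Real.pi} ∩ {v | v.im < 0}) w :=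
      hc.comp Complex.continuous_exp.continuousWithinAt fun v hv =>
        ⟨im_exp_nonpos (le_of_lt hv.2) (abs_le.1 hv.1).1, Complex.exp_ne_zero v⟩
    rw [continuousWithinAt_inter hev] at hcomp
    refine hcomp.congr_of_eventuallyEq ?_ (by simp [logSymbol, h2])
    filter_upwards [nhdsWithin_le_nhds hev] with v hv
    simp [logSymbol, not_le.2 hv]

/-- `(K(e^w) - K(e^{w₀})) e^w / (e^w - e^{w₀})`, with the singularity at `w₀` removed. -/
def keyholeIntegrand (K : ℂ → E) (w₀ w : ℂ) : E :=
  (Complex.exp w / dslope Complex.exp w₀ w) • dslope (logSymbol K) w₀ w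

theorem keyholeIntegrand_of_ne (K : ℂ → E) {w₀ w : ℂ} (h : w ≠ w₀) :
    keyholeIntegrand K w₀ w = (Complex.exp w / (Complex.exp w - Complex.exp w₀)) •
      (logSymbol K w - logSymbol K w₀) := by
  have h' : w - w₀ ≠ 0 := sub_ne_zero.2 h
  rw [keyholeIntegrand, dslope_of_ne _ h, dslope_of_ne _ h, slope, slope, vsub_eq_sub, vsub_eq_sub,
    smul_smul, smul_eq_mul]
  congr 1
  field_simp

/-- The exponential takes the value `e^{w₀}` only once on the closed strip: its period `2πi` can
identify only points of opposite edges, and `w₀` lies strictly inside. At `w₀` itself the derivative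
is nonzero. -/
theorem dslope_exp_ne_zero {w₀ w : ℂ} (h0 : |w₀.im| < Real.pi) (h1 : |w.im| ≤ Real.pi) :
    dslope Complex.exp w₀ w ≠ 0 := by
  rcases eq_or_ne w w₀ with rfl | h
  · rw [dslope_same, Complex.deriv_exp]; exact Complex.exp_ne_zero _
  · rw [dslope_of_ne _ h, slope, vsub_eq_sub, smul_eq_mul]
    refine mul_ne_zero (inv_ne_zero (sub_ne_zero.2 h)) (sub_ne_zero.2 fun he => h ?_)
    obtain ⟨n, hn⟩ := Complex.exp_eq_exp_iff_exists_int.1 he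
    rw [abs_lt] at h0
    rw [abs_le] at h1
    have him : w.im = w₀.im + n * (2 * Real.pi) := by simp [hn]
    have hpi := Real.pi_pos
    have hn1 : (n : ℝ) < 1 := by by_contra hc; nlinarith
    have hn2 : (-1 : ℝ) < n := by by_contra hc; nlinarith
    have hn0 : n = 0 := by
      have : n < 1 := by exact_mod_cast hn1
      have : -1 < n := by exact_mod_cast hn2
      omega
    simp [hn, hn0]

theorem continuousOn_keyholeIntegrand (hK : SectorialSymbol α M K) {w₀ : ℂ}
    (h0 : |w₀.im| < Real.pi) :
    ContinuousOn (keyholeIntegrand K w₀) {w : ℂ | |w.im| ≤ Real.pi} := by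
  have hn : {w : ℂ | |w.im| ≤ Real.pi} ∈ 𝓝 w₀ :=
    mem_of_superset ((isOpen_abs_im_lt Real.pi).mem_nhds h0)
      fun w (hw : |w.im| < Real.pi) => hw.le
  refine ContinuousOn.smul (ContinuousOn.div Complex.continuous_exp.continuousOn
    ((continuousOn_dslope hn).2
      ⟨Complex.continuous_exp.continuousOn, Complex.differentiableAt_exp⟩)
    fun w hw => dslope_exp_ne_zero h0 hw)
    ((continuousOn_dslope hn).2 ⟨continuousOn_logSymbol hK, differentiableAt_logSymbol hK h0⟩)

theorem differentiableAt_keyholeIntegrand (hK : SectorialSymbol α M K) {w₀ w : ℂ}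
    (h0 : |w₀.im| < Real.pi) (hw : |w.im| < Real.pi) (hne : w ≠ w₀) :
    DifferentiableAt ℂ (keyholeIntegrand K w₀) w :=
  (Complex.differentiableAt_exp.div
    ((differentiableAt_dslope_of_ne hne).2 Complex.differentiableAt_exp)
    (dslope_exp_ne_zero h0 hw.le)).smul
    ((differentiableAt_dslope_of_ne hne).2 (differentiableAt_logSymbol hK hw))

/-- Subtracting `K(e^{w₀})` turns the pole into a removable singularity, so Cauchy's theorem applies
with `w₀` as the single exceptional point and no residue. Mere continuity at the edges suffices. -/
theorem integral_keyholeIntegrand_rect [CompleteSpace E] (hK : SectorialSymbol α M K) {w₀ : ℂ}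
    (h0 : |w₀.im| < Real.pi) (R : ℝ) :
    (∫ x in -R..R, keyholeIntegrand K w₀ (x + (-Real.pi : ℝ) * Complex.I))
      - (∫ x in -R..R, keyholeIntegrand K w₀ (x + Real.pi * Complex.I))
      + Complex.I • (∫ y in -Real.pi..Real.pi, keyholeIntegrand K w₀ (R + y * Complex.I))
      - Complex.I • (∫ y in -Real.pi..Real.pi,
          keyholeIntegrand K w₀ ((-R : ℝ) + y * Complex.I)) = 0 := by
  have hpi := Real.pi_pos
  refine Complex.integral_boundary_rect_eq_zero_of_differentiable_on_off_countable
    (keyholeIntegrand K w₀) ⟨-R, -Real.pi⟩ ⟨R, Real.pi⟩ {w₀} (countable_singleton _) ?_ ?_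
  · refine (continuousOn_keyholeIntegrand hK h0).mono fun w hw => ?_
    have := hw.2
    simp only [mem_preimage, uIcc_of_le (show -Real.pi ≤ Real.pi by linarith)] at this
    exact abs_le.2 this
  · intro w hw
    have := hw.1.2
    simp only [mem_preimage, min_eq_left (show -Real.pi ≤ Real.pi by linarith),
      max_eq_right (show -Real.pi ≤ Real.pi by linarith)] at this
    exact differentiableAt_keyholeIntegrand hK h0 (abs_lt.2 this) hw.2

/-- On both edges `e^w = -e^x`, so the rational factors agree and the subtracted constants cancel,
leaving the jump of the symbol across the cut. -/
theorem keyholeIntegrand_edge_sub (K : ℂ → E) {w₀ : ℂ}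
    (h0 : |w₀.im| < Real.pi) (x : ℝ) :
    keyholeIntegrand K w₀ (x + (-Real.pi : ℝ) * Complex.I)
      - keyholeIntegrand K w₀ (x + Real.pi * Complex.I)
    = (2 * (Real.pi : ℂ) * Complex.I) • (Real.exp x •
        (((Real.exp x : ℂ) + Complex.exp w₀)⁻¹ • cutDensity K (Real.exp x))) := by
  have hpi := Real.pi_pos
  rw [abs_lt] at h0
  have e1 : Complex.exp (x + (-Real.pi : ℝ) * Complex.I) = -(Real.exp x : ℂ) := by
    rw [Complex.exp_add, Complex.ofReal_neg, neg_mul, Complex.exp_neg, Complex.exp_pi_mul_I]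
    simp
  have e2 : Complex.exp (x + Real.pi * Complex.I) = -(Real.exp x : ℂ) := by
    rw [Complex.exp_add, Complex.exp_pi_mul_I]
    simp
  have n1 : (x : ℂ) + (-Real.pi : ℝ) * Complex.I ≠ w₀ := fun h => by
    have := congrArg Complex.im h; simp at this; linarith
  have n2 : (x : ℂ) + Real.pi * Complex.I ≠ w₀ := fun h => by
    have := congrArg Complex.im h; simp at this; linarith
  have l1 : logSymbol K (x + (-Real.pi : ℝ) * Complex.I) = lowerExt K (-(Real.exp x : ℂ)) := by
    rw [logSymbol, if_neg (by simp [hpi]), e1]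
  have l2 : logSymbol K (x + Real.pi * Complex.I) = upperExt K (-(Real.exp x : ℂ)) := by
    rw [logSymbol, if_pos (by simp [hpi.le]), e2]
  have e3 : -(Real.exp x : ℂ) / (-(Real.exp x : ℂ) - Complex.exp w₀)
      = Real.exp x * ((Real.exp x : ℂ) + Complex.exp w₀)⁻¹ := by
    rw [div_eq_mul_inv, ← neg_add', inv_neg]; ring
  rw [keyholeIntegrand_of_ne K n1, keyholeIntegrand_of_ne K n2, e1, e2, l1, l2, ← smul_sub, e3,
    sub_sub_sub_cancel_right, cutDensity, ← Complex.coe_smul, smul_smul, smul_smul, smul_smul]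
  congr 1
  have : (Real.pi : ℂ) ≠ 0 := by exact_mod_cast hpi.ne'
  field_simp

end Symbol

/-! ### The weight integral and its scaling -/

section WeightIntegral

variable {α b : ℝ}

theorem integrableOn_rpow_div_one_add (hα₀ : 0 < α) (hα₁ : α < 1) (hb : 0 < b) :
    IntegrableOn (fun x : ℝ => x ^ (-α) / (1 + x * b)) (Ioi 0) := by
  have hc : ContinuousOn (fun x : ℝ => x ^ (-α) / (1 + x * b)) (Ioi 0) := by
    refine (continuousOn_rpow_Ioi _).div (Continuous.continuousOn (by fun_prop)) fun x hx => ?_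
    have : 0 < x * b := mul_pos hx hb
    positivity
  rw [← Ioc_union_Ioi_eq_Ioi (zero_le_one (α := ℝ))]
  refine IntegrableOn.union ?_ ?_
  · have h1 : IntegrableOn (fun x : ℝ => x ^ (-α)) (Ioc 0 1) :=
      (intervalIntegrable_iff_integrableOn_Ioc_of_le zero_le_one).1
        (intervalIntegral.intervalIntegrable_rpow' (by linarith))
    refine Integrable.mono' h1 ((hc.mono fun x hx => hx.1).aestronglyMeasurable measurableSet_Ioc)
      ((ae_restrict_iff' measurableSet_Ioc).2 (ae_of_all _ fun x hx => ?_))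
    have hx0 : 0 < x * b := mul_pos hx.1 hb
    have hp := Real.rpow_nonneg hx.1.le (-α)
    rw [Real.norm_of_nonneg (by positivity)]
    exact div_le_self hp (by linarith)
  · have h1 : IntegrableOn (fun x : ℝ => b⁻¹ * x ^ (-α - 1)) (Ioi 1) :=
      (integrableOn_Ioi_rpow_of_lt (by linarith) one_pos).const_mul _
    refine Integrable.mono' h1 ((hc.mono fun x (hx : 1 < x) =>
      zero_lt_one.trans hx).aestronglyMeasurable measurableSet_Ioi)
      ((ae_restrict_iff' measurableSet_Ioi).2 (ae_of_all _ fun x hx => ?_))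
    have hx0 : 0 < x := zero_lt_one.trans hx
    have hp := Real.rpow_nonneg hx0.le (-α)
    rw [Real.norm_of_nonneg (by positivity), Real.rpow_sub_one hx0.ne',
      div_le_iff₀ (by positivity)]
    have : b⁻¹ * (x ^ (-α) / x) * (1 + x * b) = x ^ (-α) + b⁻¹ * (x ^ (-α) / x) := by
      field_simp; ring
    rw [this]
    have : 0 ≤ b⁻¹ * (x ^ (-α) / x) := by positivity
    linarith

theorem integral_rpow_div_one_add (α : ℝ) (hb : 0 < b) :
    ∫ x in Ioi (0 : ℝ), x ^ (-α) / (1 + x * b)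
      = (∫ x in Ioi (0 : ℝ), x ^ (-α) / (1 + x)) * b ^ (α - 1) := by
  have h := integral_comp_mul_left_Ioi (fun x : ℝ => x ^ (-α) / (1 + x)) 0 hb
  have e : ∫ x in Ioi (0 : ℝ), (b * x) ^ (-α) / (1 + b * x)
      = b ^ (-α) * ∫ x in Ioi (0 : ℝ), x ^ (-α) / (1 + x * b) := by
    rw [← integral_const_mul]
    refine setIntegral_congr_fun measurableSet_Ioi fun x hx => ?_
    rw [Real.mul_rpow hb.le (le_of_lt hx), mul_comm b x]; ring
  rw [e, mul_zero, smul_eq_mul] at h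
  have hp := Real.rpow_pos_of_pos hb (-α)
  have e2 : b ^ (α - 1) = b⁻¹ * (b ^ (-α))⁻¹ := by
    rw [Real.rpow_neg hb.le, inv_inv, Real.rpow_sub_one hb.ne']; field_simp
  have h' : ∫ x in Ioi (0 : ℝ), x ^ (-α) / (1 + x * b)
      = (b ^ (-α))⁻¹ * (b ^ (-α) * ∫ x in Ioi (0 : ℝ), x ^ (-α) / (1 + x * b)) := by
    rw [inv_mul_cancel_left₀ hp.ne']
  rw [h', h, e2]
  ring

theorem integral_rpow_div_one_add_nonneg (α : ℝ) :
    0 ≤ ∫ x in Ioi (0 : ℝ), x ^ (-α) / (1 + x) :=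
  setIntegral_nonneg measurableSet_Ioi fun x (hx : 0 < x) => by positivity

end WeightIntegral

/-! ### Stieltjes representation of the symbol -/

section Stieltjes

variable {E : Type*} [NormedAddCommGroup E] [NormedSpace ℂ E] {α M : ℝ} {K : ℂ → E}

theorem norm_inv_add_le {z : ℂ} (hz : 0 < z.re) {x : ℝ} (hx : 0 < x) :
    ‖((x : ℂ) + z)⁻¹‖ ≤ z.re⁻¹ * (1 / (1 + x * z.re⁻¹)) := by
  have h1 : x + z.re ≤ ‖(x : ℂ) + z‖ := by
    have := Complex.re_le_norm ((x : ℂ) + z); simpa using this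
  have h2 : z.re⁻¹ * (1 / (1 + x * z.re⁻¹)) = (x + z.re)⁻¹ := by field_simp; ring
  rw [h2, norm_inv]
  exact inv_anti₀ (by positivity) h1

theorem integrableOn_inv_add_smul_cutDensity (hK : SectorialSymbol α M K) (hα₀ : 0 < α)
    (hα₁ : α < 1) {z : ℂ} (hz : 0 < z.re) :
    IntegrableOn (fun x : ℝ => ((x : ℂ) + z)⁻¹ • cutDensity K x) (Ioi 0) := by
  have hi := (integrableOn_rpow_div_one_add hα₀ hα₁ (inv_pos.2 hz)).const_mul
    (z.re⁻¹ * (M / Real.pi))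
  refine Integrable.mono' hi (ContinuousOn.aestronglyMeasurable ?_ measurableSet_Ioi)
    ((ae_restrict_iff' measurableSet_Ioi).2 (ae_of_all _ fun x hx => ?_))
  · refine ContinuousOn.smul (ContinuousOn.inv₀ (Continuous.continuousOn (by fun_prop))
      fun x hx => ?_) (continuousOn_cutDensity hK)
    intro h
    have := congrArg Complex.re h
    have hx' : 0 < x := hx
    simp at this
    linarith
  · rw [norm_smul]
    have h1 := norm_inv_add_le hz (mem_Ioi.1 hx)
    have h2 := norm_cutDensity_le hK (mem_Ioi.1 hx)
    calc _ ≤ (z.re⁻¹ * (1 / (1 + x * z.re⁻¹))) * (M / Real.pi * x ^ (-α)) :=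
          mul_le_mul h1 h2 (norm_nonneg _) ((norm_nonneg _).trans h1)
      _ = _ := by ring

theorem integral_comp_exp {F : Type*} [NormedAddCommGroup F] [NormedSpace ℝ F] (g : ℝ → F) :
    ∫ x, Real.exp x • g (Real.exp x) = ∫ y in Ioi 0, g y := by
  have := integral_image_eq_integral_abs_deriv_smul (MeasurableSet.univ)
    (fun x _ => (Real.hasDerivAt_exp x).hasDerivWithinAt) Real.exp_injective.injOn g
  rw [image_univ, Real.range_exp] at this
  rw [this, setIntegral_univ]
  simp

theorem integrable_comp_exp {F : Type*} [NormedAddCommGroup F] [NormedSpace ℝ F] {g : ℝ → F}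
    (hg : IntegrableOn g (Ioi 0)) : Integrable fun x => Real.exp x • g (Real.exp x) := by
  have := integrableOn_image_iff_integrableOn_abs_deriv_smul (MeasurableSet.univ)
    (fun x _ => (Real.hasDerivAt_exp x).hasDerivWithinAt) Real.exp_injective.injOn g
  rw [image_univ, Real.range_exp, integrableOn_univ] at this
  simpa using this.1 hg

/-- Far to the right `e^w / (e^w - z) = 1 + z / (e^w - z)` is close to `1` and `K(e^w)` is small
when `α > 0`, so the integrand tends to `-K z`: the right edge supplies the value of the symbol. -/
theorem norm_keyholeIntegrand_add_le (hK : SectorialSymbol α M K) {w₀ w : ℂ}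
    (h0 : |w₀.im| < Real.pi) (hw : |w.im| ≤ Real.pi)
    (hR : 2 * ‖Complex.exp w₀‖ ≤ Real.exp w.re) :
    ‖keyholeIntegrand K w₀ w + K (Complex.exp w₀)‖
      ≤ 2 * M * Real.exp (-α * w.re)
        + 2 * ‖Complex.exp w₀‖ * ‖K (Complex.exp w₀)‖ * Real.exp (-w.re) := by
  set z := Complex.exp w₀
  have hz : 0 < ‖z‖ := norm_pos_iff.2 (Complex.exp_ne_zero _)
  have hlt : Real.exp w.re / 2 ≤ ‖Complex.exp w - z‖ := by
    have := norm_sub_norm_le (Complex.exp w) z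
    rw [Complex.norm_exp] at this
    linarith
  have hpos : 0 < ‖Complex.exp w - z‖ := by have := Real.exp_pos w.re; linarith
  have hne : Complex.exp w - z ≠ 0 := norm_pos_iff.1 hpos
  have hww : w ≠ w₀ := by rintro rfl; exact hne (sub_self _)
  rw [keyholeIntegrand_of_ne K hww, logSymbol_eq hK h0]
  have e : (Complex.exp w / (Complex.exp w - z)) • (logSymbol K w - K z) + K z
      = (Complex.exp w / (Complex.exp w - z)) • logSymbol K w
        - (z / (Complex.exp w - z)) • K z := by
    have : Complex.exp w / (Complex.exp w - z) = 1 + z / (Complex.exp w - z) := by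
      field_simp; ring
    rw [this]; module
  rw [e]
  have hl := norm_logSymbol_le hK hw
  refine (norm_sub_le _ _).trans (add_le_add ?_ ?_)
  · rw [norm_smul, norm_div, Complex.norm_exp]
    have : Real.exp w.re / ‖Complex.exp w - z‖ ≤ 2 := by
      rw [div_le_iff₀ hpos]; linarith
    calc _ ≤ 2 * (M * Real.exp (-α * w.re)) :=
          mul_le_mul this hl (norm_nonneg _) (by norm_num)
      _ = _ := by ring
  · rw [norm_smul, norm_div]
    have : ‖z‖ / ‖Complex.exp w - z‖ ≤ 2 * ‖z‖ * Real.exp (-w.re) := by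
      rw [div_le_iff₀ hpos, Real.exp_neg]
      have := mul_le_mul_of_nonneg_left hlt (by positivity : 0 ≤ 2 * ‖z‖ * (Real.exp w.re)⁻¹)
      refine le_trans (le_of_eq ?_) this
      have := (Real.exp_pos w.re).ne'
      field_simp
    calc _ ≤ (2 * ‖z‖ * Real.exp (-w.re)) * ‖K z‖ :=
          mul_le_mul_of_nonneg_right this (norm_nonneg _)
      _ = _ := by ring

/-- Far to the left the factor `e^w / (e^w - z)` is of order `e^{Re w}`, which beats the growth
`e^{-α Re w}` of the symbol when `α < 1`; the left edge then contributes nothing in the limit. -/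
theorem norm_keyholeIntegrand_le (hK : SectorialSymbol α M K) {w₀ w : ℂ}
    (h0 : |w₀.im| < Real.pi) (hw : |w.im| ≤ Real.pi)
    (hR : 2 * Real.exp w.re ≤ ‖Complex.exp w₀‖) :
    ‖keyholeIntegrand K w₀ w‖ ≤ 2 / ‖Complex.exp w₀‖ *
      (M * Real.exp ((1 - α) * w.re) + ‖K (Complex.exp w₀)‖ * Real.exp w.re) := by
  set z := Complex.exp w₀
  have hz : 0 < ‖z‖ := norm_pos_iff.2 (Complex.exp_ne_zero _)
  have hlt : ‖z‖ / 2 ≤ ‖Complex.exp w - z‖ := by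
    have := norm_sub_norm_le z (Complex.exp w)
    rw [norm_sub_rev, Complex.norm_exp w] at this
    linarith
  have hpos : 0 < ‖Complex.exp w - z‖ := by linarith
  have hne : Complex.exp w - z ≠ 0 := norm_pos_iff.1 hpos
  have hww : w ≠ w₀ := by rintro rfl; exact hne (sub_self _)
  rw [keyholeIntegrand_of_ne K hww, logSymbol_eq hK h0, norm_smul, norm_div, Complex.norm_exp]
  have h1 : Real.exp w.re / ‖Complex.exp w - z‖ ≤ 2 / ‖z‖ * Real.exp w.re := by
    rw [div_le_iff₀ hpos]
    have := mul_le_mul_of_nonneg_left hlt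
      (by have := Real.exp_pos w.re; positivity : 0 ≤ 2 / ‖z‖ * Real.exp w.re)
    refine le_trans (le_of_eq ?_) this
    field_simp
  have h2 := (norm_sub_le (logSymbol K w) (K z)).trans
    (add_le_add_left (norm_logSymbol_le hK hw) _)
  calc _ ≤ (2 / ‖z‖ * Real.exp w.re) * (M * Real.exp (-α * w.re) + ‖K z‖) :=
        mul_le_mul h1 h2 (norm_nonneg _) (by have := Real.exp_pos w.re; positivity)
    _ = _ := by
      rw [show (1 - α) * w.re = w.re + -α * w.re by ring, Real.exp_add]; ring

theorem eq_integral_inv_add_smul_cutDensity [CompleteSpace E] (hK : SectorialSymbol α M K)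
    (hα₀ : 0 < α) (hα₁ : α < 1) {z : ℂ} (hz : 0 < z.re) :
    K z = ∫ x in Ioi (0 : ℝ), ((x : ℂ) + z)⁻¹ • cutDensity K x := by
  have hpi := Real.pi_pos
  have hzs : z ∈ Complex.slitPlane := Or.inl hz
  have hz0 := Complex.slitPlane_ne_zero hzs
  set w₀ := Complex.log z with hw₀
  have hexp : Complex.exp w₀ = z := Complex.exp_log hz0
  have h0 : |w₀.im| < Real.pi := by
    rw [hw₀, Complex.log_im, abs_lt]
    exact ⟨Complex.neg_pi_lt_arg z,
      (Complex.arg_le_pi z).lt_of_ne (Complex.mem_slitPlane_iff_arg.1 hzs).1⟩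
  set F : ℝ → E := fun x => Real.exp x •
    (((Real.exp x : ℂ) + z)⁻¹ • cutDensity K (Real.exp x)) with hF
  have hgi := integrableOn_inv_add_smul_cutDensity hK hα₀ hα₁ hz
  have hFi : Integrable F := integrable_comp_exp hgi
  have hFe : ∫ x, F x = ∫ x in Ioi (0 : ℝ), ((x : ℂ) + z)⁻¹ • cutDensity K x :=
    integral_comp_exp fun x : ℝ => ((x : ℂ) + z)⁻¹ • cutDensity K x
  rw [← hFe]
  have hcont := continuousOn_keyholeIntegrand hK h0
  have hhor : ∀ c R : ℝ, |c| ≤ Real.pi → IntervalIntegrable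
      (fun x : ℝ => keyholeIntegrand K w₀ (x + c * Complex.I)) volume (-R) R := fun c R hc =>
    (hcont.comp_continuous (by fun_prop) fun x => by simpa using hc).intervalIntegrable _ _
  have hver : ∀ R : ℝ, IntervalIntegrable
      (fun y : ℝ => keyholeIntegrand K w₀ (R + y * Complex.I)) volume (-Real.pi) Real.pi :=
    fun R => (hcont.comp (Continuous.continuousOn (by fun_prop)) fun y hy => by
      rw [uIcc_of_le (by linarith)] at hy
      simpa using abs_le.2 hy).intervalIntegrable
  have hlim : Tendsto (fun R : ℝ => ∫ x in -R..R, F x) atTop (𝓝 (∫ x, F x)) :=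
    intervalIntegral_tendsto_integral hFi tendsto_neg_atTop_atBot tendsto_id
  -- The contour identity rearranged: the horizontal edges combine into `F`, and adding `K z` under
  -- the right edge integral, of length `2π`, accounts for the `2πi K z` on the left.
  have hsplit : ∀ R : ℝ, (2 * (Real.pi : ℂ) * Complex.I) • ((∫ x in -R..R, F x) - K z)
      = Complex.I • (∫ y in -Real.pi..Real.pi, keyholeIntegrand K w₀ ((-R : ℝ) + y * Complex.I))
        - Complex.I •
          (∫ y in -Real.pi..Real.pi, (keyholeIntegrand K w₀ (R + y * Complex.I) + K z)) := by
    intro R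
    have hr := integral_keyholeIntegrand_rect hK h0 R
    rw [← intervalIntegral.integral_sub (hhor _ _ (by rw [abs_neg, abs_of_pos hpi]))
      (hhor _ _ (by rw [abs_of_pos hpi]))] at hr
    simp only [keyholeIntegrand_edge_sub K h0, hexp] at hr
    rw [intervalIntegral.integral_smul] at hr
    rw [intervalIntegral.integral_add (hver R) (by simp), intervalIntegral.integral_const,
      sub_neg_eq_add, ← Complex.coe_smul]
    rw [smul_sub, smul_add, smul_smul]
    have e : Complex.I * ((Real.pi + Real.pi : ℝ) : ℂ) = 2 * (Real.pi : ℂ) * Complex.I := by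
      push_cast; ring
    rw [e, ← sub_eq_zero, ← hr]
    abel
  have hbound : ∀ᶠ R : ℝ in atTop, ‖(2 * (Real.pi : ℂ) * Complex.I) • ((∫ x in -R..R, F x) - K z)‖
      ≤ (2 / ‖z‖ * (M * Real.exp ((1 - α) * -R) + ‖K z‖ * Real.exp (-R))) * (2 * Real.pi)
        + (2 * M * Real.exp (-α * R) + 2 * ‖z‖ * ‖K z‖ * Real.exp (-R)) * (2 * Real.pi) := by
    have hz' : 0 < ‖z‖ := norm_pos_iff.2 hz0
    have hev1 : ∀ᶠ R : ℝ in atTop, 2 * ‖z‖ ≤ Real.exp R :=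
      Real.tendsto_exp_atTop.eventually_ge_atTop _
    have hev2 : ∀ᶠ R : ℝ in atTop, 2 / ‖z‖ ≤ Real.exp R :=
      Real.tendsto_exp_atTop.eventually_ge_atTop _
    filter_upwards [hev1, hev2] with R h1 h2
    have h2' : 2 * Real.exp (-R) ≤ ‖z‖ := by
      rw [Real.exp_neg, ← div_eq_mul_inv, div_le_iff₀ (Real.exp_pos _)]
      rw [div_le_iff₀ hz'] at h2; linarith
    have him : ∀ y ∈ uIoc (-Real.pi) Real.pi, |y| ≤ Real.pi := fun y hy => by
      rw [uIoc_of_le (by linarith)] at hy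
      exact abs_le.2 ⟨hy.1.le, hy.2⟩
    have hlen : |Real.pi - -Real.pi| = 2 * Real.pi := by
      rw [abs_of_pos (by linarith)]; ring
    rw [hsplit]
    refine (norm_sub_le _ _).trans (add_le_add ?_ ?_)
    · rw [norm_smul, Complex.norm_I, one_mul, ← hlen]
      refine intervalIntegral.norm_integral_le_of_norm_le_const fun y hy => ?_
      have := norm_keyholeIntegrand_le hK (w := ((-R : ℝ) : ℂ) + y * Complex.I) h0
        (by simpa using him y hy) (by simpa [hexp] using h2')
      simpa [hexp] using this
    · rw [norm_smul, Complex.norm_I, one_mul, ← hlen]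
      refine intervalIntegral.norm_integral_le_of_norm_le_const fun y hy => ?_
      have := norm_keyholeIntegrand_add_le hK (w := (R : ℂ) + y * Complex.I) h0
        (by simpa using him y hy) (by simpa [hexp] using h1)
      simpa [hexp] using this
  have hexp0 : ∀ c : ℝ, 0 < c → Tendsto (fun R : ℝ => Real.exp (-(c * R))) atTop (𝓝 0) :=
    fun c hc => Real.tendsto_exp_neg_atTop_nhds_zero.comp (tendsto_id.const_mul_atTop hc)
  have hzero : Tendsto (fun R : ℝ =>
      (2 / ‖z‖ * (M * Real.exp ((1 - α) * -R) + ‖K z‖ * Real.exp (-R))) * (2 * Real.pi)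
        + (2 * M * Real.exp (-α * R) + 2 * ‖z‖ * ‖K z‖ * Real.exp (-R)) * (2 * Real.pi))
      atTop (𝓝 0) := by
    have a1 := hexp0 (1 - α) (by linarith)
    have a2 := hexp0 1 one_pos
    have a3 := hexp0 α hα₀
    have := (((a1.const_mul M).add (a2.const_mul ‖K z‖)).const_mul (2 / ‖z‖)).mul_const
      (2 * Real.pi) |>.add ((((a3.const_mul (2 * M)).add
        (a2.const_mul (2 * ‖z‖ * ‖K z‖)))).mul_const (2 * Real.pi))
    simpa using this
  have hnorm := squeeze_zero_norm' hbound hzero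
  have hdiff : Tendsto (fun R : ℝ => (2 * (Real.pi : ℂ) * Complex.I) • ((∫ x in -R..R, F x) - K z))
      atTop (𝓝 ((2 * (Real.pi : ℂ) * Complex.I) • ((∫ x, F x) - K z))) :=
    (hlim.sub_const (K z)).const_smul _
  have := tendsto_nhds_unique hdiff hnorm
  have hne : (2 * (Real.pi : ℂ) * Complex.I) ≠ 0 := Complex.two_pi_I_ne_zero
  exact (sub_eq_zero.1 ((smul_eq_zero.1 this).resolve_left hne)).symm

end Stieltjes

/-! ### Uniqueness of Laplace transforms -/

section LaplaceUniqueness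

variable {E : Type*} [NormedAddCommGroup E] [NormedSpace ℂ E] [CompleteSpace E]

open scoped FourierTransform ContDiff in
-- Every test function is `𝓕 φ` with `φ` Schwartz, and `∫ (𝓕 φ) h = ∫ φ (𝓕 h) = 0`; a locally
-- integrable function annihilated by all test functions vanishes almost everywhere.
theorem ae_eq_zero_of_fourier_eq_zero {h : ℝ → E} (hi : Integrable h) (h0 : ∀ w, 𝓕 h w = 0) :
    ∀ᵐ t, h t = 0 := by
  refine ae_eq_zero_of_integral_contDiff_smul_eq_zero hi.locallyIntegrable fun g hg hgs => ?_
  have hg₁ : HasCompactSupport (Complex.ofRealCLM ∘ g) := hgs.comp_left rfl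
  have hg₂ : ContDiff ℝ ∞ (Complex.ofRealCLM ∘ g) := by fun_prop
  set φ : SchwartzMap ℝ ℂ := 𝓕⁻ (hg₁.toSchwartzMap hg₂) with hφ
  have e : ∀ t, g t • h t = (𝓕 (φ : ℝ → ℂ) t) • h t := fun t => by
    have : 𝓕 φ = hg₁.toSchwartzMap hg₂ := by rw [hφ]; simp
    rw [← SchwartzMap.fourier_coe, this]
    simp
  have key := VectorFourier.integral_fourierIntegral_smul_eq_flip (L := innerₗ ℝ) (μ := volume)
    (ν := volume) Real.continuous_fourierChar continuous_inner φ.integrable hi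
  have key' : ∫ t, (𝓕 (φ : ℝ → ℂ) t) • h t = ∫ t, (φ t) • 𝓕 h t := by
    simpa using! key
  simp_rw [e]
  rw [key']
  simp [h0]

/-- On a single vertical line the Laplace transform is the Fourier transform of `e^{-at} h(t)`
extended by zero. -/
theorem ae_eq_zero_of_laplace_eq_zero {h : ℝ → E} {a : ℝ}
    (hi : IntegrableOn (fun t : ℝ => Complex.exp (-(a : ℂ) * t) • h t) (Ioi 0))
    (h0 : ∀ z : ℂ, z.re = a → ∫ t in Ioi (0 : ℝ), Complex.exp (-z * t) • h t = 0) :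
    ∀ᵐ t ∂volume.restrict (Ioi (0 : ℝ)), h t = 0 := by
  have hz := ae_eq_zero_of_fourier_eq_zero ((integrable_indicator_iff measurableSet_Ioi).2 hi)
    fun w => by
      rw [Real.fourier_real_eq_integral_exp_smul, ← h0 (a + 2 * Real.pi * w * Complex.I) (by simp),
        ← integral_indicator measurableSet_Ioi]
      congr 1
      funext t
      by_cases ht : t ∈ Ioi (0 : ℝ)
      · rw [indicator_of_mem ht, indicator_of_mem ht, smul_smul, ← Complex.exp_add]
        congr 2
        push_cast
        ring
      · rw [indicator_of_notMem ht, indicator_of_notMem ht, smul_zero]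
  rw [ae_restrict_iff' measurableSet_Ioi]
  filter_upwards [hz] with t ht hmem
  rw [indicator_of_mem hmem] at ht
  exact (smul_eq_zero.1 ht).resolve_left (Complex.exp_ne_zero _)

end LaplaceUniqueness

/-! ### Recovering the kernel from the cut density -/

section Inversion

variable {E : Type*} [NormedAddCommGroup E] [NormedSpace ℂ E] {α M : ℝ} {K : ℂ → E}

/-- The kernel `∫_0^∞ e^{-xt} G(x) dx` recovered from the cut density `G` of its transform. -/
def cutKernel (K : ℂ → E) (t : ℝ) : E :=
  ∫ x in Ioi (0 : ℝ), Real.exp (-x * t) • cutDensity K x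

/-- Tonelli with `t` integrated first: what remains is `‖G(x)‖ / (x + Re z)`, which is integrable
for `0 < α < 1`. -/
theorem integrable_exp_smul_cutDensity_prod (hK : SectorialSymbol α M K) (hα₀ : 0 < α)
    (hα₁ : α < 1) {z : ℂ} (hz : 0 < z.re) :
    Integrable (Function.uncurry fun t x : ℝ =>
        Complex.exp (-(x + z) * t) • cutDensity K x)
      ((volume.restrict (Ioi 0)).prod (volume.restrict (Ioi 0))) := by
  have hG : AEStronglyMeasurable (cutDensity K) (volume.restrict (Ioi 0)) :=
    (continuousOn_cutDensity hK).aestronglyMeasurable measurableSet_Ioi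
  have hmeas : AEStronglyMeasurable (Function.uncurry fun t x : ℝ =>
        Complex.exp (-(x + z) * t) • cutDensity K x)
      ((volume.restrict (Ioi 0)).prod (volume.restrict (Ioi 0))) :=
    (Continuous.aestronglyMeasurable (by fun_prop :
      Continuous fun p : ℝ × ℝ => Complex.exp (-((p.2 : ℂ) + z) * p.1))).smul hG.comp_snd
  have hre : ∀ x : ℝ, 0 < x → (-((x : ℂ) + z)).re < 0 := fun x hx => by simp; linarith
  rw [integrable_prod_iff' hmeas]
  constructor
  · refine (ae_restrict_iff' measurableSet_Ioi).2 (ae_of_all _ fun x hx => ?_)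
    exact Integrable.smul_const (integrableOn_exp_mul_complex_Ioi (hre x hx) 0) (cutDensity K x)
  · have hi := (integrableOn_rpow_div_one_add hα₀ hα₁ (inv_pos.2 hz)).const_mul
      (z.re⁻¹ * (M / Real.pi))
    refine Integrable.mono' hi hmeas.norm.prod_swap.integral_prod_right'
      ((ae_restrict_iff' measurableSet_Ioi).2 (ae_of_all _ fun x hx => ?_))
    have hx0 : 0 < x := hx
    have e : ∫ t in Ioi (0 : ℝ), ‖Complex.exp (-(x + z) * t) • cutDensity K x‖
        = (x + z.re)⁻¹ * ‖cutDensity K x‖ := by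
      simp_rw [norm_smul, Complex.norm_exp]
      rw [integral_mul_const]
      congr 1
      have := integral_exp_mul_Ioi (a := -(x + z.re)) (by linarith) 0
      rw [mul_zero, Real.exp_zero, neg_div_neg_eq, one_div] at this
      rw [← this]
      congr 1
      funext t
      simp
    simp only [Function.uncurry]
    rw [e, Real.norm_of_nonneg (by positivity)]
    have h2 : z.re⁻¹ * (1 / (1 + x * z.re⁻¹)) = (x + z.re)⁻¹ := by field_simp; ring
    calc _ ≤ (x + z.re)⁻¹ * (M / Real.pi * x ^ (-α)) :=
          mul_le_mul_of_nonneg_left (norm_cutDensity_le hK hx) (by positivity)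
      _ = _ := by rw [← h2]; ring

theorem exp_smul_cutKernel (K : ℂ → E) (z : ℂ) (t : ℝ) :
    Complex.exp (-z * t) • cutKernel K t
      = ∫ x in Ioi (0 : ℝ), Complex.exp (-(x + z) * t) • cutDensity K x := by
  rw [cutKernel, ← integral_smul]
  congr 1
  funext x
  rw [← Complex.coe_smul, smul_smul, Complex.ofReal_exp, ← Complex.exp_add]
  congr 2
  push_cast
  ring

theorem integrableOn_exp_smul_cutKernel (hK : SectorialSymbol α M K) (hα₀ : 0 < α)
    (hα₁ : α < 1) {z : ℂ} (hz : 0 < z.re) :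
    IntegrableOn (fun t : ℝ => Complex.exp (-z * t) • cutKernel K t) (Ioi 0) := by
  simp_rw [exp_smul_cutKernel]
  exact (integrable_exp_smul_cutDensity_prod hK hα₀ hα₁ hz).integral_prod_left

theorem laplace_cutKernel [CompleteSpace E] (hK : SectorialSymbol α M K) (hα₀ : 0 < α)
    (hα₁ : α < 1) {z : ℂ} (hz : 0 < z.re) :
    ∫ t in Ioi (0 : ℝ), Complex.exp (-z * t) • cutKernel K t = K z := by
  simp_rw [exp_smul_cutKernel]
  rw [integral_integral_swap (integrable_exp_smul_cutDensity_prod hK hα₀ hα₁ hz),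
    eq_integral_inv_add_smul_cutDensity hK hα₀ hα₁ hz]
  refine setIntegral_congr_fun measurableSet_Ioi fun x hx => ?_
  have hx0 : 0 < x := hx
  rw [integral_smul_const, integral_exp_mul_complex_Ioi (by simp; linarith) 0]
  rw [Complex.ofReal_zero, mul_zero, Complex.exp_zero, neg_div_neg_eq, one_div]

/-- Both kernels have transform `K` on a line `Re z = a` with `a > max σ 0`, where both integrals
converge. -/
theorem ae_eq_cutKernel [CompleteSpace E] (hK : SectorialSymbol α M K) (hα₀ : 0 < α)
    (hα₁ : α < 1) {k : ℝ → E} (hk : IsLaplaceTransform k K) :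
    ∀ᵐ t ∂volume.restrict (Ioi (0 : ℝ)), k t = cutKernel K t := by
  obtain ⟨σ, hσ⟩ := hk
  set a := max σ 0 + 1
  have ha : σ < a := (le_max_left σ 0).trans_lt (lt_add_one _)
  have ha0 : 0 < a := (le_max_right σ 0).trans_lt (lt_add_one _)
  have h := ae_eq_zero_of_laplace_eq_zero (h := fun t => k t - cutKernel K t) (a := a) ?_ ?_
  · filter_upwards [h] with t ht using sub_eq_zero.1 ht
  · simp_rw [smul_sub]
    exact ((hσ a (by simpa using ha)).1).sub
      (integrableOn_exp_smul_cutKernel hK hα₀ hα₁ (by simpa using ha0))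
  · intro z hz
    simp_rw [smul_sub]
    rw [integral_sub (hσ z (by rwa [hz])).1
      (integrableOn_exp_smul_cutKernel hK hα₀ hα₁ (by rwa [hz])), ← (hσ z (by rwa [hz])).2,
      laplace_cutKernel hK hα₀ hα₁ (by rwa [hz]), sub_self]

end Inversion

/-! ### The convolution as a superposition of relaxation equations -/

section Representation

variable {X Y : Type*} [NormedAddCommGroup X] [NormedSpace ℂ X]
  [NormedAddCommGroup Y] [NormedSpace ℂ Y] {α β M : ℝ} {K : ℂ → X →L[ℂ] Y}

theorem aestronglyMeasurable_cutDensity {E : Type*} [NormedAddCommGroup E] [NormedSpace ℂ E]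
    {K : ℂ → E} (hK : SectorialSymbol α M K) :
    AEStronglyMeasurable (cutDensity K) (volume.restrict (Ioi 0)) :=
  (continuousOn_cutDensity hK).aestronglyMeasurable measurableSet_Ioi

theorem exp_neg_le_one_div_one_add {r : ℝ} (hr : 0 ≤ r) : Real.exp (-r) ≤ 1 / (1 + r) := by
  rw [Real.exp_neg, ← one_div]
  exact one_div_le_one_div_of_le (by positivity) (by linarith [Real.add_one_le_exp r])

theorem integrableOn_exp_smul_cutDensity {E : Type*} [NormedAddCommGroup E] [NormedSpace ℂ E]
    {K : ℂ → E} (hK : SectorialSymbol α M K) (hα₀ : 0 < α) (hα₁ : α < 1) {t : ℝ} (ht : 0 < t) :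
    IntegrableOn (fun x : ℝ => Real.exp (-x * t) • cutDensity K x) (Ioi 0) := by
  have hc : Continuous fun x : ℝ => Real.exp (-x * t) := by fun_prop
  refine Integrable.mono' ((integrableOn_rpow_div_one_add hα₀ hα₁ ht).const_mul (M / Real.pi))
    (hc.aestronglyMeasurable.smul (aestronglyMeasurable_cutDensity hK))
    ((ae_restrict_iff' measurableSet_Ioi).2 (ae_of_all _ fun x (hx : 0 < x) => ?_))
  rw [norm_smul, Real.norm_of_nonneg (Real.exp_pos _).le, neg_mul]
  calc _ ≤ 1 / (1 + x * t) * (M / Real.pi * x ^ (-α)) :=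
        mul_le_mul (exp_neg_le_one_div_one_add (by positivity)) (norm_cutDensity_le hK hx)
          (norm_nonneg _) (by positivity)
    _ = _ := by ring

/-- Integrating in `s` first gives a bound of order `1 / (1 + xτ)` by `expConv_rpow_le`, exactly the
decay needed against `x^{-α}` at infinity. -/
theorem integrable_exp_smul_cutDensity_apply_prod (hK : SectorialSymbol α M K) (hα₀ : 0 < α)
    (hα₁ : α < 1) (hβ : -1 < β) {f : ℝ → X} {B τ : ℝ} (hτ : 0 < τ) (hB0 : 0 ≤ B)
    (hf : AEStronglyMeasurable f (volume.restrict (Ioc 0 τ)))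
    (hB : ∀ s ∈ Ioc 0 τ, ‖f s‖ ≤ B * s ^ β) :
    Integrable (Function.uncurry fun s x : ℝ =>
        cutDensity K x (Real.exp (-x * (τ - s)) • f s))
      ((volume.restrict (Ioc 0 τ)).prod (volume.restrict (Ioi 0))) := by
  have hG := aestronglyMeasurable_cutDensity hK
  have hmeas : AEStronglyMeasurable (Function.uncurry fun s x : ℝ =>
        cutDensity K x (Real.exp (-x * (τ - s)) • f s))
      ((volume.restrict (Ioc 0 τ)).prod (volume.restrict (Ioi 0))) := by
    have hc : Continuous fun p : ℝ × ℝ => Real.exp (-p.2 * (τ - p.1)) := by fun_prop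
    have h1 : AEStronglyMeasurable (fun p : ℝ × ℝ => Real.exp (-p.2 * (τ - p.1)) • f p.1)
        ((volume.restrict (Ioc 0 τ)).prod (volume.restrict (Ioi 0))) :=
      hc.aestronglyMeasurable.smul hf.comp_fst
    exact (ContinuousLinearMap.id ℂ (X →L[ℂ] Y)).aestronglyMeasurable_comp₂ hG.comp_snd h1
  have hpow : IntegrableOn (fun s : ℝ => s ^ β) (Ioc 0 τ) :=
    (intervalIntegrable_iff_integrableOn_Ioc_of_le hτ.le).1
      (intervalIntegral.intervalIntegrable_rpow' hβ)
  have hexpow : ∀ x : ℝ, IntegrableOn (fun s : ℝ => Real.exp (-x * (τ - s)) * s ^ β) (Ioc 0 τ) :=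
    fun x => (intervalIntegrable_iff_integrableOn_Ioc_of_le hτ.le).1
      ((intervalIntegral.intervalIntegrable_rpow' hβ).continuousOn_mul
        (Continuous.continuousOn (by fun_prop)))
  have hpt : ∀ x : ℝ, ∀ s ∈ Ioc 0 τ, ‖cutDensity K x (Real.exp (-x * (τ - s)) • f s)‖
      ≤ ‖cutDensity K x‖ * B * (Real.exp (-x * (τ - s)) * s ^ β) := fun x s hs => by
    refine ((cutDensity K x).le_opNorm _).trans ?_
    rw [norm_smul, Real.norm_of_nonneg (Real.exp_pos _).le, mul_assoc]
    refine mul_le_mul_of_nonneg_left ?_ (norm_nonneg _)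
    calc _ ≤ Real.exp (-x * (τ - s)) * (B * s ^ β) :=
          mul_le_mul_of_nonneg_left (hB s hs) (Real.exp_pos _).le
      _ = _ := by ring
  rw [integrable_prod_iff' hmeas]
  constructor
  · refine ae_of_all _ fun x => ?_
    have hc : Continuous fun s : ℝ => Real.exp (-x * (τ - s)) := by fun_prop
    refine Integrable.mono' ((hexpow x).const_mul (‖cutDensity K x‖ * B))
      ((cutDensity K x).continuous.comp_aestronglyMeasurable
        (hc.aestronglyMeasurable.smul hf))
      ((ae_restrict_iff' measurableSet_Ioc).2 (ae_of_all _ (hpt x)))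
  · obtain ⟨C, hC, hy⟩ := expConv_rpow_le hβ
    have hi := (integrableOn_rpow_div_one_add hα₀ hα₁ hτ).const_mul
      (M / Real.pi * B * (C * τ ^ (β + 1)))
    refine Integrable.mono' hi hmeas.norm.prod_swap.integral_prod_right'
      ((ae_restrict_iff' measurableSet_Ioi).2 (ae_of_all _ fun x (hx : 0 < x) => ?_))
    rw [Real.norm_of_nonneg (integral_nonneg fun _ => norm_nonneg _)]
    have hy' := hy x τ hx.le hτ
    rw [expConv, intervalIntegral.integral_of_le hτ.le] at hy'
    calc ∫ s in Ioc 0 τ, ‖cutDensity K x (Real.exp (-x * (τ - s)) • f s)‖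
        ≤ ∫ s in Ioc 0 τ, ‖cutDensity K x‖ * B * (Real.exp (-x * (τ - s)) * s ^ β) := by
          refine integral_mono_of_nonneg (ae_of_all _ fun _ => norm_nonneg _)
            ((hexpow x).const_mul _)
            ((ae_restrict_iff' measurableSet_Ioc).2 (ae_of_all _ (hpt x)))
      _ = ‖cutDensity K x‖ * B * ∫ s in Ioc 0 τ, Real.exp (-x * (τ - s)) * s ^ β :=
          integral_const_mul _ _
      _ ≤ (M / Real.pi * x ^ (-α)) * B * (C * (τ ^ (β + 1) / (1 + x * τ))) := by
          have h1 := norm_cutDensity_le hK hx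
          refine mul_le_mul (mul_le_mul_of_nonneg_right h1 hB0) hy' ?_
            (mul_nonneg ((norm_nonneg _).trans h1) hB0)
          exact integral_nonneg_of_ae ((ae_restrict_iff' measurableSet_Ioc).2
            (ae_of_all _ fun s hs => mul_nonneg (Real.exp_pos _).le (Real.rpow_nonneg hs.1.le _)))
      _ = _ := by ring

theorem integrableOn_of_norm_le_rpow {X : Type*} [NormedAddCommGroup X] {β : ℝ} (hβ : -1 < β)
    {f : ℝ → X} {B τ : ℝ} (hτ : 0 < τ)
    (hf : AEStronglyMeasurable f (volume.restrict (Ioc 0 τ)))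
    (hB : ∀ s ∈ Ioc 0 τ, ‖f s‖ ≤ B * s ^ β) : IntegrableOn f (Ioc 0 τ) := by
  have hpow : IntegrableOn (fun s : ℝ => s ^ β) (Ioc 0 τ) :=
    (intervalIntegrable_iff_integrableOn_Ioc_of_le hτ.le).1
      (intervalIntegral.intervalIntegrable_rpow' hβ)
  exact Integrable.mono' (hpow.const_mul B) hf
    ((ae_restrict_iff' measurableSet_Ioc).2 (ae_of_all _ hB))

variable [CompleteSpace X] [CompleteSpace Y]

theorem cutDensity_expConv_eq (K : ℂ → X →L[ℂ] Y) {f : ℝ → X} {τ : ℝ} (hτ : 0 < τ)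
    (hf : IntegrableOn f (Ioc 0 τ)) (x : ℝ) :
    cutDensity K x (expConv x f τ)
      = ∫ s in Ioc 0 τ, cutDensity K x (Real.exp (-x * (τ - s)) • f s) := by
  rw [expConv, intervalIntegral.integral_of_le hτ.le]
  refine ((cutDensity K x).integral_comp_comm ?_).symm
  exact (intervalIntegrable_iff_integrableOn_Ioc_of_le hτ.le).1
    (((intervalIntegrable_iff_integrableOn_Ioc_of_le hτ.le).2 hf).continuousOn_smul
        (Continuous.continuousOn (by fun_prop)))

theorem integrableOn_cutDensity_expConv (hK : SectorialSymbol α M K) (hα₀ : 0 < α)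
    (hα₁ : α < 1) (hβ : -1 < β) {f : ℝ → X} {B τ : ℝ} (hτ : 0 < τ) (hB0 : 0 ≤ B)
    (hf : AEStronglyMeasurable f (volume.restrict (Ioc 0 τ)))
    (hB : ∀ s ∈ Ioc 0 τ, ‖f s‖ ≤ B * s ^ β) :
    IntegrableOn (fun x => cutDensity K x (expConv x f τ)) (Ioi 0) := by
  simp_rw [cutDensity_expConv_eq K hτ (integrableOn_of_norm_le_rpow hβ hτ hf hB)]
  exact (integrable_exp_smul_cutDensity_apply_prod hK hα₀ hα₁ hβ hτ hB0 hf hB).integral_prod_right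

theorem convolve_eq_integral_cutDensity (hK : SectorialSymbol α M K) (hα₀ : 0 < α)
    (hα₁ : α < 1) (hβ : -1 < β) {k : ℝ → X →L[ℂ] Y} (hk : IsLaplaceTransform k K)
    {f : ℝ → X} {B τ : ℝ} (hτ : 0 < τ) (hB0 : 0 ≤ B)
    (hf : AEStronglyMeasurable f (volume.restrict (Ioc 0 τ)))
    (hB : ∀ s ∈ Ioc 0 τ, ‖f s‖ ≤ B * s ^ β) :
    convolve k f τ = ∫ x in Ioi (0 : ℝ), cutDensity K x (expConv x f τ) := by
  simp_rw [cutDensity_expConv_eq K hτ (integrableOn_of_norm_le_rpow hβ hτ hf hB)]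
  rw [← integral_integral_swap
    (integrable_exp_smul_cutDensity_apply_prod hK hα₀ hα₁ hβ hτ hB0 hf hB), convolve,
    intervalIntegral.integral_of_le hτ.le]
  have hk' := (ae_restrict_iff' measurableSet_Ioi).1 (ae_eq_cutKernel hK hα₀ hα₁ hk)
  have hk'' : ∀ᵐ s : ℝ, τ - s ∈ Ioi (0 : ℝ) → k (τ - s) = cutKernel K (τ - s) :=
    (quasiMeasurePreserving_sub_left volume τ).ae hk'
  -- The kernel is identified only at positive arguments, so the endpoint `s = τ` is discarded as a
  -- null set.
  have hne : ∀ᵐ s : ℝ, s ≠ τ := by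
    rw [ae_iff]; simp
  refine setIntegral_congr_ae measurableSet_Ioc ?_
  filter_upwards [hk'', hne] with s h1 h2 hs
  have hpos : 0 < τ - s := sub_pos.2 (hs.2.lt_of_ne h2)
  rw [h1 hpos, cutKernel, ContinuousLinearMap.integral_apply
    (integrableOn_exp_smul_cutDensity hK hα₀ hα₁ hpos)]
  congr 1
  funext x
  simp

end Representation

/-! ### From Euler errors to the quadrature error -/

section Quadrature

variable {X Y : Type*} [NormedAddCommGroup X] [NormedSpace ℂ X]
  [NormedAddCommGroup Y] [NormedSpace ℂ Y] {α β M : ℝ} {K : ℂ → X →L[ℂ] Y}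

theorem integrableOn_cutDensity_eulerApprox (hK : SectorialSymbol α M K) (hα₀ : 0 < α)
    (hα₁ : α < 1) {t : ℕ → ℝ} {n : ℕ} (ht : ∀ l, 1 ≤ l → l ≤ n → 0 < stepSize t l) (f : ℝ → X) :
    IntegrableOn (fun x => cutDensity K x (eulerApprox t f n x)) (Ioi 0) := by
  simp_rw [eulerApprox, map_sum]
  refine integrable_finsetSum _ fun j hj => ?_
  rw [Finset.mem_Icc] at hj
  have hτ := ht j hj.1 hj.2
  have hmeas : AEStronglyMeasurable (fun x : ℝ =>
      (stepSize t j * ∏ l ∈ Finset.Icc j n, 1 / (1 + stepSize t l * x)) • f (t j))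
      (volume.restrict (Ioi 0)) := by
    have hc : ContinuousOn (fun x : ℝ =>
        stepSize t j * ∏ l ∈ Finset.Icc j n, 1 / (1 + stepSize t l * x)) (Ioi 0) := by
      refine continuousOn_const.mul (continuousOn_finsetProd _ fun l hl => ?_)
      rw [Finset.mem_Icc] at hl
      refine continuousOn_const.div (Continuous.continuousOn (by fun_prop)) fun x hx => ?_
      have : 0 < stepSize t l * x := mul_pos (ht l (hj.1.trans hl.1) hl.2) hx
      positivity
    exact (hc.smul continuousOn_const).aestronglyMeasurable measurableSet_Ioi
  refine Integrable.mono' ((integrableOn_rpow_div_one_add hα₀ hα₁ hτ).const_mul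
    (M / Real.pi * (stepSize t j * ‖f (t j)‖)))
    ((ContinuousLinearMap.id ℂ (X →L[ℂ] Y)).aestronglyMeasurable_comp₂
      (aestronglyMeasurable_cutDensity hK) hmeas)
    ((ae_restrict_iff' measurableSet_Ioi).2 (ae_of_all _ fun x (hx : 0 < x) => ?_))
  have hst : ∀ l, j ≤ l → l ≤ n → 0 ≤ stepSize t l := fun l h1 h2 => (ht l (hj.1.trans h1) h2).le
  have hg0 := eulerFactor_nonneg hx.le hst
  have hg := eulerFactor_le hx.le hj.2 hst
  refine ((cutDensity K x).le_opNorm _).trans ?_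
  have h1 := norm_cutDensity_le hK hx
  rw [← eulerFactor, norm_smul, norm_mul, Real.norm_of_nonneg hτ.le, Real.norm_of_nonneg hg0]
  calc _ ≤ (M / Real.pi * x ^ (-α)) *
        (stepSize t j * (1 / (1 + stepSize t j * x)) * ‖f (t j)‖) := by
        refine mul_le_mul h1 ?_ (by positivity) ((norm_nonneg _).trans h1)
        exact mul_le_mul_of_nonneg_right (mul_le_mul_of_nonneg_left hg hτ.le) (norm_nonneg _)
    _ = _ := by rw [mul_comm x]; ring

variable [CompleteSpace X] [CompleteSpace Y]

theorem norm_convolve_sub_gCQ_le (hK : SectorialSymbol α M K) (hα₀ : 0 < α)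
    (hα₁ : α < 1) (hβ : -1 < β) {k : ℝ → X →L[ℂ] Y} (hk : IsLaplaceTransform k K)
    {t : ℕ → ℝ} {n : ℕ} (ht0 : ∀ j, 1 ≤ j → j ≤ n → 0 < t j) (hn : 1 ≤ n)
    (ht : ∀ l, 1 ≤ l → l ≤ n → 0 < stepSize t l)
    {f : ℝ → X} {B : ℝ} (hB0 : 0 ≤ B)
    (hf : AEStronglyMeasurable f (volume.restrict (Ioc 0 (t n))))
    (hB : ∀ s ∈ Ioc 0 (t n), ‖f s‖ ≤ B * s ^ β) {A : ℕ → ℝ}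
    (hA : ∀ x : ℝ, 0 < x → ‖expConv x f (t n) - eulerApprox t f n x‖
      ≤ ∑ j ∈ Finset.Icc 1 n, A j / (1 + x * t j)) :
    ‖convolve k f (t n) - gCQ K t f n‖
      ≤ M / Real.pi * (∫ x in Ioi (0 : ℝ), x ^ (-α) / (1 + x)) *
        ∑ j ∈ Finset.Icc 1 n, A j * t j ^ (α - 1) := by
  have hτ := ht0 n hn le_rfl
  rw [convolve_eq_integral_cutDensity hK hα₀ hα₁ hβ hk hτ hB0 hf hB, gCQ,
    ← integral_sub (integrableOn_cutDensity_expConv hK hα₀ hα₁ hβ hτ hB0 hf hB)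
      (integrableOn_cutDensity_eulerApprox hK hα₀ hα₁ ht f)]
  have hi : ∀ j ∈ Finset.Icc 1 n, IntegrableOn
      (fun x : ℝ => M / Real.pi * A j * (x ^ (-α) / (1 + x * t j))) (Ioi 0) := fun j hj => by
    rw [Finset.mem_Icc] at hj
    exact (integrableOn_rpow_div_one_add hα₀ hα₁ (ht0 j hj.1 hj.2)).const_mul _
  refine (norm_integral_le_of_norm_le (g := fun x : ℝ => ∑ j ∈ Finset.Icc 1 n,
    M / Real.pi * A j * (x ^ (-α) / (1 + x * t j))) (integrable_finsetSum _ hi)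
    ((ae_restrict_iff' measurableSet_Ioi).2 (ae_of_all _ fun x (hx : 0 < x) => ?_))).trans
    (le_of_eq ?_)
  · rw [← map_sub]
    refine ((cutDensity K x).le_opNorm _).trans ?_
    have h1 := norm_cutDensity_le hK hx
    refine (mul_le_mul h1 (hA x hx) (norm_nonneg _) ((norm_nonneg _).trans h1)).trans (le_of_eq ?_)
    rw [Finset.mul_sum]
    exact Finset.sum_congr rfl fun j _ => by ring
  · rw [integral_finsetSum _ hi, Finset.mul_sum]
    refine Finset.sum_congr rfl fun j hj => ?_
    rw [Finset.mem_Icc] at hj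
    rw [integral_const_mul, integral_rpow_div_one_add α (ht0 j hj.1 hj.2)]
    ring

end Quadrature

/-! ### Defect bounds with constants uniform in the order -/

theorem half_le_Gamma {x : ℝ} (hx : 1 ≤ x) : 1 / 2 ≤ Real.Gamma x := by
  have h2 : ∀ y : ℝ, 2 ≤ y → 1 ≤ Real.Gamma y := fun y hy => by
    have := Real.Gamma_strictMonoOn_Ici.monotoneOn (mem_Ici.2 le_rfl) (mem_Ici.2 hy) hy
    rwa [Real.Gamma_two] at this
  rcases le_or_gt 2 x with h | h
  · linarith [h2 x h]
  · have h3 := h2 (x + 1) (by linarith)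
    rw [Real.Gamma_add_one (by linarith)] at h3
    nlinarith [Real.Gamma_pos_of_pos (show 0 < x by linarith)]

section Linear

variable {X : Type*} [NormedAddCommGroup X] [NormedSpace ℝ X]

theorem expConv_congr {f g : ℝ → X} {s : ℝ} (hs : 0 ≤ s) (h : EqOn f g (Ioc 0 s)) (x : ℝ) :
    expConv x f s = expConv x g s := by
  rw [expConv, expConv, intervalIntegral.integral_of_le hs, intervalIntegral.integral_of_le hs]
  exact setIntegral_congr_fun measurableSet_Ioc fun u hu => by simp only [h hu]

theorem eulerDefect_congr {f g : ℝ → X} {a b : ℝ} (ha : 0 ≤ a) (hab : a < b)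
    (h : EqOn f g (Ioc 0 b)) (x : ℝ) : eulerDefect x f a b = eulerDefect x g a b := by
  rw [eulerDefect, eulerDefect, expConv_congr (ha.trans hab.le) h,
    expConv_congr ha (h.mono (Ioc_subset_Ioc_right hab.le)), h ⟨ha.trans_lt hab, le_rfl⟩]

theorem expConv_add {f g : ℝ → X} {s : ℝ} (hf : IntervalIntegrable f volume 0 s)
    (hg : IntervalIntegrable g volume 0 s) (x : ℝ) :
    expConv x (fun u => f u + g u) s = expConv x f s + expConv x g s := by
  have hc : ContinuousOn (fun u : ℝ => Real.exp (-x * (s - u))) (uIcc 0 s) :=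
    Continuous.continuousOn (by fun_prop)
  simp only [expConv, smul_add]
  exact intervalIntegral.integral_add (hf.continuousOn_smul hc) (hg.continuousOn_smul hc)

theorem eulerDefect_add {f g : ℝ → X} {a b : ℝ} (hf : ∀ s, IntervalIntegrable f volume 0 s)
    (hg : ∀ s, IntervalIntegrable g volume 0 s) (x : ℝ) :
    eulerDefect x (fun u => f u + g u) a b = eulerDefect x f a b + eulerDefect x g a b := by
  rw [eulerDefect, eulerDefect, eulerDefect, expConv_add (hf b) (hg b), expConv_add (hf a) (hg a)]
  module

theorem eulerDefect_sum {ι : Type*} (S : Finset ι) {f : ι → ℝ → X} {a b : ℝ}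
    (hf : ∀ i s, IntervalIntegrable (f i) volume 0 s) (x : ℝ) :
    eulerDefect x (fun u => ∑ i ∈ S, f i u) a b = ∑ i ∈ S, eulerDefect x (f i) a b := by
  classical
  induction S using Finset.induction_on with
  | empty => simp [eulerDefect, expConv]
  | insert i S hi ih =>
    have hsum : ∀ s, IntervalIntegrable (fun u => ∑ i ∈ S, f i u) volume 0 s := fun s => by
      have := IntervalIntegrable.sum S (f := f) (μ := volume) (a := 0) (b := s) fun i _ => hf i s
      convert! this using 1
      funext u; simp
    simp only [Finset.sum_insert hi]
    rw [eulerDefect_add (hf i) hsum, ih]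

theorem eulerDefect_smul_const [CompleteSpace X] (φ : ℝ → ℝ) (c : X) (x a b : ℝ) :
    eulerDefect x (fun u => φ u • c) a b = eulerDefect x φ a b • c := by
  have h : ∀ s, expConv x (fun u => φ u • c) s = expConv x φ s • c := fun s => by
    rw [expConv, expConv, ← intervalIntegral.integral_smul_const]
    simp only [smul_assoc]
  rw [eulerDefect, eulerDefect, h, h]
  simp only [smul_eq_mul]
  module

end Linear

section UniformBounds

variable {β : ℝ}

/-- For `γ ≥ 2` the derivative of `s^γ` is Lipschitz and the primitive bound applies with constant
`2γ(γ-1)`. Since `Γ(γ+1) = γ(γ-1) Γ(γ-1)` and `Γ(γ-1) ≥ 1/2`, this is at most `4 Γ(γ+1)`. -/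
theorem abs_eulerDefect_rpow_le_of_two_le {γ : ℝ} (hγ : 2 ≤ γ) {x a b : ℝ} (hx : 0 ≤ x)
    (ha : 0 ≤ a) (hab : a < b) :
    |eulerDefect x (fun u => u ^ γ) a b|
      ≤ 4 * Real.Gamma (γ + 1) * ((b - a) ^ 2 * b ^ (γ - 1)) / (1 + x * b) := by
  have hb := ha.trans_lt hab
  have hprim : ∀ v, ∫ u in (0 : ℝ)..v, γ * truncPow (γ - 1) u = truncPow γ v := fun v => by
    rw [intervalIntegral.integral_const_mul, integral_zero_truncPow (by linarith), sub_add_cancel]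
    field_simp
  have h := norm_eulerDefect_primitive_le (h := fun u => γ * truncPow (γ - 1) u)
    (a := a) (b := b) (L := γ * ((γ - 1) * b ^ (γ - 2))) (x := x)
    (continuous_const.mul (continuous_truncPow (by linarith)))
    (fun u hu => by rw [truncPow_of_nonpos (by linarith) hu, mul_zero])
    (fun s s' hs hs' => by
      have h1 := truncPow_sub_le (δ := γ - 1) (by linarith) hs hs' hb.le
      have h2 := monotone_truncPow (δ := γ - 1) (by linarith) hs
      rw [show γ - 1 - 1 = γ - 2 by ring] at h1
      rw [← mul_sub, Real.norm_of_nonneg (mul_nonneg (by linarith) (by linarith)), mul_assoc]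
      exact mul_le_mul_of_nonneg_left h1 (by linarith))
    (mul_nonneg (by linarith) (mul_nonneg (by linarith) (Real.rpow_nonneg hb.le _))) hx ha hab.le
  simp_rw [hprim] at h
  rw [eulerDefect_congr (g := truncPow γ) ha hab
    (fun u hu => (truncPow_of_nonneg hu.1.le).symm), ← Real.norm_eq_abs]
  refine h.trans ?_
  have e1 : b ^ (γ - 1) = b ^ (γ - 2) * b := by
    rw [← Real.rpow_add_one hb.ne']; congr 1; ring
  have e2 : Real.Gamma (γ + 1) = γ * ((γ - 1) * Real.Gamma (γ - 1)) := by
    rw [Real.Gamma_add_one (by linarith)]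
    nth_rewrite 2 [show γ = γ - 1 + 1 by ring]
    rw [Real.Gamma_add_one (by linarith)]
  rw [e1, e2]
  have hG := half_le_Gamma (x := γ - 1) (by linarith)
  have hp := Real.rpow_nonneg hb.le (γ - 2)
  have hk : 0 ≤ (b - a) ^ 2 * (γ * ((γ - 1) * b ^ (γ - 2))) * (2 * b / (1 + x * b)) := by
    have : 0 ≤ γ - 1 := by linarith
    positivity
  calc _ ≤ (b - a) ^ 2 * (γ * ((γ - 1) * b ^ (γ - 2))) * (2 * b / (1 + x * b))
        * (2 * Real.Gamma (γ - 1)) := le_mul_of_one_le_right hk (by linarith)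
    _ = _ := by ring

theorem abs_eulerDefect_rpow_le_nonneg {γ : ℝ} (hγ : -1 < γ) : ∃ C : ℝ, 0 ≤ C ∧
    ∀ x a b : ℝ, 0 ≤ x → 0 ≤ a → a < b → |eulerDefect x (fun u => u ^ γ) a b| / (1 + x * (b - a))
      ≤ C * ((b - a) ^ 2 * b ^ (γ - 1)) / (1 + x * b) := by
  obtain ⟨C, hC, h⟩ := abs_eulerDefect_rpow_le hγ
  obtain ⟨C', hC', h'⟩ := abs_eulerDefect_zero_rpow_le hγ
  refine ⟨C + C', by positivity, fun x a b hx ha hab => ?_⟩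
  have hb := ha.trans_lt hab
  have hp := Real.rpow_nonneg hb.le (γ - 1)
  rcases ha.eq_or_lt with rfl | ha0
  · have := h' x b hx hb
    rw [sub_zero]
    refine this.trans (div_le_div_of_nonneg_right ?_ (by positivity))
    have e : b ^ (γ + 1) = b ^ 2 * b ^ (γ - 1) := by
      rw [← Real.rpow_natCast, ← Real.rpow_add hb]; congr 1; push_cast; ring
    rw [e]
    exact mul_le_mul_of_nonneg_right (by linarith) (by positivity)
  · refine (h x a b hx ha0 hab).trans (div_le_div_of_nonneg_right ?_ (by positivity))
    exact mul_le_mul_of_nonneg_right (by linarith) (by positivity)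

theorem exists_uniform_eulerDefect_rpow_le (hβ : -1 < β) : ∃ C : ℝ, 0 ≤ C ∧
    ∀ (l : ℕ) (x a b : ℝ), 0 ≤ x → 0 ≤ a → a < b →
      |eulerDefect x (fun u => u ^ ((l : ℝ) + β)) a b| / (1 + x * (b - a))
        ≤ C * Real.Gamma (l + β + 1) * ((b - a) ^ 2 * b ^ ((l : ℝ) + β - 1)) / (1 + x * b) := by
  have hγ : ∀ l : ℕ, -1 < (l : ℝ) + β := fun l => by
    have : (0 : ℝ) ≤ l := Nat.cast_nonneg l
    linarith
  have hG : ∀ l : ℕ, 0 < Real.Gamma (l + β + 1) := fun l =>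
    Real.Gamma_pos_of_pos (by linarith [hγ l])
  choose c hc0 hc using fun l : ℕ => abs_eulerDefect_rpow_le_nonneg (hγ l)
  have hterm : ∀ l, 0 ≤ c l / Real.Gamma (l + β + 1) := fun l => div_nonneg (hc0 l) (hG l).le
  have hsum : 0 ≤ ∑ l ∈ Finset.range 3, c l / Real.Gamma (l + β + 1) :=
    Finset.sum_nonneg fun l _ => hterm l
  -- For `l ≥ 3` the exponent `l + β` exceeds `2` and the constant `4` serves; the remaining orders
  -- `0, 1, 2` are covered by a finite sum depending only on `β`.
  refine ⟨4 + ∑ l ∈ Finset.range 3, c l / Real.Gamma (l + β + 1), by positivity,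
    fun l x a b hx ha hab => ?_⟩
  have hb := ha.trans_lt hab
  have hp := Real.rpow_nonneg hb.le ((l : ℝ) + β - 1)
  rcases lt_or_ge l 3 with hl | hl
  · refine (hc l x a b hx ha hab).trans (div_le_div_of_nonneg_right ?_ (by positivity))
    refine mul_le_mul_of_nonneg_right ?_ (by positivity)
    have h1 := Finset.single_le_sum (f := fun l : ℕ => c l / Real.Gamma (l + β + 1))
      (fun l _ => hterm l) (Finset.mem_range.2 hl)
    rw [← div_le_iff₀ (hG l)]
    linarith
  · have h3 : (3 : ℝ) ≤ l := by exact_mod_cast hl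
    have hba : 0 ≤ x * (b - a) := mul_nonneg hx (by linarith)
    refine (div_le_self (abs_nonneg _) (by linarith)).trans
      ((abs_eulerDefect_rpow_le_of_two_le (by linarith) hx ha hab).trans
        (div_le_div_of_nonneg_right ?_ (by positivity)))
    refine mul_le_mul_of_nonneg_right (mul_le_mul_of_nonneg_right ?_ (hG l).le) (by positivity)
    linarith

theorem norm_eulerDefect_truncConv_le {X : Type*} [NormedAddCommGroup X] [NormedSpace ℝ X]
    [CompleteSpace X] {γ T : ℝ} (hγ : 1 < γ) (hT : 0 ≤ T) {g : ℝ → X}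
    (hg : IntervalIntegrable g volume 0 T) {x a b S : ℝ} (hx : 0 ≤ x) (ha : 0 ≤ a) (hab : a < b)
    (hbT : b ≤ T) (hS0 : 0 ≤ S) (hS : ∀ u ∈ Ioc 0 b, ‖g u‖ ≤ S) :
    ‖eulerDefect x (fun v => ∫ u in (0 : ℝ)..v,
        (1 / Real.Gamma γ) • truncConv (γ - 1) T g u) a b‖
      ≤ 4 * ((b - a) ^ 2 * b ^ γ * S) / (1 + x * b) := by
  have hb := ha.trans_lt hab
  have hGh := half_le_Gamma hγ.le
  have hG : 1 / Real.Gamma γ ≤ 2 := by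
    rw [div_le_iff₀ (by linarith)]; linarith
  have hG0 : 0 ≤ 1 / Real.Gamma γ := by
    have : 0 < Real.Gamma γ := by linarith
    positivity
  have hp := Real.rpow_nonneg hb.le (γ - 1)
  have h := norm_eulerDefect_primitive_le
    (h := fun u => (1 / Real.Gamma γ) • truncConv (γ - 1) T g u)
    (a := a) (b := b) (L := 2 * (S * b ^ (γ - 1))) (x := x)
    ((continuous_truncConv (by linarith) hT hg).const_smul _)
    (fun u hu => by rw [truncConv_of_nonpos (by linarith) hT hu, smul_zero])
    (fun s s' hs hs' => by
      have h1 := norm_truncConv_sub_le (δ := γ - 1) (by linarith) hT hg hb.le hbT hS0 hS hs hs'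
      rw [← smul_sub, norm_smul, Real.norm_of_nonneg hG0, mul_assoc]
      exact mul_le_mul hG h1 (norm_nonneg _) (by norm_num))
    (by positivity) hx ha hab.le
  refine h.trans (le_of_eq ?_)
  have e1 : b ^ γ = b ^ (γ - 1) * b := by
    rw [← Real.rpow_add_one hb.ne']; congr 1; ring
  rw [e1]; ring

theorem integral_truncConv_div_Gamma {X : Type*} [NormedAddCommGroup X] [NormedSpace ℝ X]
    [CompleteSpace X] {γ T : ℝ} (hγ : 1 < γ) (hT : 0 ≤ T) {g : ℝ → X}
    (hg : IntervalIntegrable g volume 0 T) {s : ℝ} (hs : 0 ≤ s) (hsT : s ≤ T) :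
    ∫ u in (0 : ℝ)..s, (1 / Real.Gamma γ) • truncConv (γ - 1) T g u
      = (1 / Real.Gamma (γ + 1)) • ∫ u in (0 : ℝ)..s, (s - u) ^ γ • g u := by
  rw [intervalIntegral.integral_smul, integral_truncConv (by linarith) hT hg hs, sub_add_cancel,
    truncConv_eq_integral (by linarith) hg hs hsT, smul_smul, Real.Gamma_add_one (by linarith)]
  congr 1
  field_simp

end UniformBounds

/-! ### Mesh points and the choice of `ξ_j` -/

section Mesh

/-- Powers are continuous at `b > 0`, so any point close enough to `b` from the left serves finitely
many exponents at once. -/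
theorem exists_mem_Ioo_rpow_le {a b : ℝ} (hb : 0 < b) (hab : a < b) (D : Finset ℝ) :
    ∃ ξ ∈ Ioo a b, ∀ δ ∈ D, b ^ δ ≤ 2 * ξ ^ δ := by
  have h : ∀ᶠ ξ in 𝓝[<] b, ∀ δ ∈ D, b ^ δ ≤ 2 * ξ ^ δ := by
    rw [Finset.eventually_all]
    intro δ _
    have hc : Tendsto (fun ξ : ℝ => 2 * ξ ^ δ) (𝓝[<] b) (𝓝 (2 * b ^ δ)) :=
      ((Real.continuousAt_rpow_const b δ (Or.inl hb.ne')).tendsto.mono_left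
        nhdsWithin_le_nhds).const_mul 2
    have hp := Real.rpow_pos_of_pos hb δ
    exact (hc.eventually_const_lt (by linarith)).mono fun _ h => h.le
  obtain ⟨ξ, h1, h2⟩ := (h.and (Ioo_mem_nhdsLT hab)).exists
  exact ⟨ξ, h2, h1⟩

variable {t : ℕ → ℝ} {N : ℕ} {T : ℝ}

theorem IsTimeMesh.stepSize_pos (h : IsTimeMesh t N T) {j : ℕ} (h1 : 1 ≤ j) (h2 : j ≤ N) :
    0 < stepSize t j := by
  have := h.step (j - 1) (by omega)
  rw [Nat.sub_add_cancel h1] at this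
  exact sub_pos.2 this

theorem IsTimeMesh.monotone (h : IsTimeMesh t N T) {i j : ℕ} (hij : i ≤ j) (hj : j ≤ N) :
    t i ≤ t j := by
  induction j, hij using Nat.le_induction with
  | base => exact le_rfl
  | succ j _ ih => exact (ih (by omega)).trans (h.step j (by omega)).le

theorem IsTimeMesh.nonneg (h : IsTimeMesh t N T) {j : ℕ} (hj : j ≤ N) : 0 ≤ t j := by
  rw [← h.zero]; exact h.monotone (Nat.zero_le j) hj

theorem IsTimeMesh.pos (h : IsTimeMesh t N T) {j : ℕ} (h1 : 1 ≤ j) (hj : j ≤ N) : 0 < t j := by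
  have h2 := h.stepSize_pos h1 hj
  have h3 := h.nonneg (j := j - 1) (by omega)
  rw [stepSize] at h2
  linarith

theorem IsTimeMesh.le_last (h : IsTimeMesh t N T) {j : ℕ} (hj : j ≤ N) : t j ≤ T := by
  rw [← h.last]; exact h.monotone hj le_rfl

end Mesh

/-! ### Measurability and suprema of the fractional derivative -/

section RiemannLiouville

variable {X : Type*} [NormedAddCommGroup X] [NormedSpace ℝ X] [CompleteSpace X]

/-- Away from the endpoint `T` the outermost derivative within `(0, T]` is an ordinary derivative,
and derivatives are measurable without any regularity assumption. -/
theorem aestronglyMeasurable_rlDeriv (T : ℝ) {μ : ℝ} (hμ : 0 ≤ μ) (f : ℝ → X) :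
    AEStronglyMeasurable (rlDeriv T μ f) (volume.restrict (Ioc 0 T)) := by
  have hfl : 0 ≤ ⌊μ⌋ := Int.floor_nonneg.2 hμ
  obtain ⟨m, hm⟩ : ∃ m : ℕ, (⌊μ⌋ + 1).toNat = m + 1 := ⟨⌊μ⌋.toNat, by omega⟩
  refine (aestronglyMeasurable_deriv
    (iteratedDerivWithin m (fracInt (((m + 1 : ℕ) : ℝ) - μ) f) (Ioc 0 T)) _).congr ?_
  have hne : ∀ᵐ s : ℝ, s ≠ T := by
    rw [ae_iff]; simp
  rw [EventuallyEq, ae_restrict_iff' measurableSet_Ioc]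
  filter_upwards [hne] with s hs hmem
  rw [rlDeriv, hm, iteratedDerivWithin_succ,
    derivWithin_of_mem_nhds (Ioc_mem_nhds hmem.1 (hmem.2.lt_of_ne hs))]

theorem norm_le_supNorm {X : Type*} [NormedAddCommGroup X] [NormedSpace ℝ X] {g : ℝ → X}
    {B T b s : ℝ} (hB : ∀ s ∈ Ioc 0 T, ‖g s‖ ≤ B) (hb : b ≤ T) (hs : s ∈ Ioc 0 b) :
    ‖g s‖ ≤ supNorm g b := by
  refine le_ciSup (f := fun s : Ioc (0 : ℝ) b => ‖g s‖) ⟨B, ?_⟩ ⟨s, hs⟩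
  rintro _ ⟨u, rfl⟩
  exact hB u ⟨u.2.1, u.2.2.trans hb⟩

theorem supNorm_nonneg {X : Type*} [NormedAddCommGroup X] [NormedSpace ℝ X] (g : ℝ → X) (b : ℝ) :
    0 ≤ supNorm g b := Real.iSup_nonneg fun _ => norm_nonneg _

end RiemannLiouville

/-! ### The fractional Taylor expansion and its defect -/

section Error

variable {X : Type*} [NormedAddCommGroup X] [NormedSpace ℂ X] [CompleteSpace X]

/-- The continuous function on `(0, ∞)` that agrees with `f` on `(0, T]`, given the coefficients `v`
and the density `g` of the fractional Taylor expansion of `f` at `0`. -/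
def fracTaylor (β T : ℝ) (p : ℕ) (v : ℕ → X) (g : ℝ → X) (s : ℝ) : X :=
  ∑ l ∈ Finset.range (p + 1), s ^ ((l : ℝ) + β) • ((1 / Real.Gamma (l + β + 1)) • v l)
    + ∫ u in (0 : ℝ)..s, (1 / Real.Gamma (p + β)) • truncConv (p + β - 1) T g u

variable {β T : ℝ} {p : ℕ} {v : ℕ → X} {g : ℝ → X}

theorem continuous_fracTaylor_remainder (hp : 1 < p + β) (hT : 0 ≤ T)
    (hg : IntervalIntegrable g volume 0 T) : Continuous fun s : ℝ =>
      ∫ u in (0 : ℝ)..s, (1 / Real.Gamma (p + β)) • truncConv (p + β - 1) T g u :=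
  continuous_iff_continuousAt.2 fun s =>
    (((continuous_truncConv (by linarith) hT hg).const_smul
      (1 / Real.Gamma (p + β))).integral_hasStrictDerivAt 0 s).hasDerivAt.continuousAt

theorem continuousOn_fracTaylor (hp : 1 < p + β) (hT : 0 ≤ T)
    (hg : IntervalIntegrable g volume 0 T) : ContinuousOn (fracTaylor β T p v g) (Ioi 0) :=
  (continuousOn_finsetSum _ fun _ _ => (continuousOn_rpow_Ioi _).smul continuousOn_const).add
    (continuous_fracTaylor_remainder hp hT hg).continuousOn

/-- Needed only for integrability; `B` never enters the error constant. The exponent is `min β 0`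
because the remainder is merely known to be bounded, while the leading power may be singular. -/
theorem exists_norm_fracTaylor_le (hp : 1 < p + β) (hT : 0 ≤ T)
    (hg : IntervalIntegrable g volume 0 T) : ∃ B : ℝ, 0 ≤ B ∧
      ∀ s ∈ Ioc 0 T, ‖fracTaylor β T p v g s‖ ≤ B * s ^ min β 0 := by
  obtain ⟨D, hD⟩ := isCompact_Icc.exists_bound_of_continuousOn (s := Icc 0 T)
    (continuous_fracTaylor_remainder hp hT hg).continuousOn
  have hD0 : 0 ≤ D := (norm_nonneg _).trans (hD 0 ⟨le_rfl, hT⟩)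
  have hpow : ∀ δ, min β 0 ≤ δ → ∀ s ∈ Ioc 0 T, s ^ δ ≤ T ^ (δ - min β 0) * s ^ min β 0 := by
    intro δ hδ s hs
    have h1 : s ^ (δ - min β 0) ≤ T ^ (δ - min β 0) :=
      Real.rpow_le_rpow hs.1.le hs.2 (by linarith)
    have h2 : s ^ δ = s ^ (δ - min β 0) * s ^ min β 0 := by
      rw [← Real.rpow_add hs.1, sub_add_cancel]
    rw [h2]
    exact mul_le_mul_of_nonneg_right h1 (Real.rpow_nonneg hs.1.le _)
  refine ⟨∑ l ∈ Finset.range (p + 1), T ^ ((l : ℝ) + β - min β 0) *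
    ‖(1 / Real.Gamma (l + β + 1)) • v l‖ + T ^ (0 - min β 0) * D,
    add_nonneg (Finset.sum_nonneg fun l _ => mul_nonneg (Real.rpow_nonneg hT _) (norm_nonneg _))
      (mul_nonneg (Real.rpow_nonneg hT _) hD0), fun s hs => ?_⟩
  rw [fracTaylor, add_mul, Finset.sum_mul]
  refine (norm_add_le _ _).trans (add_le_add ((norm_sum_le _ _).trans
    (Finset.sum_le_sum fun l _ => ?_)) ?_)
  · rw [norm_smul, Real.norm_of_nonneg (Real.rpow_nonneg hs.1.le _), mul_right_comm]
    have hl : (0 : ℝ) ≤ l := Nat.cast_nonneg l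
    exact mul_le_mul_of_nonneg_right
      (hpow _ (by linarith [min_le_left β 0]) s hs) (norm_nonneg _)
  · have h1 := hpow 0 (min_le_right β 0) s hs
    rw [Real.rpow_zero] at h1
    calc _ ≤ D * 1 := by rw [mul_one]; exact hD s ⟨hs.1.le, hs.2⟩
      _ ≤ D * (T ^ (0 - min β 0) * s ^ min β 0) := mul_le_mul_of_nonneg_left h1 hD0
      _ = _ := by ring

theorem norm_eulerDefect_fracTaylor_le (hβ : -1 < β) {C : ℝ} (hC : ∀ (l : ℕ) (x a b : ℝ),
      0 ≤ x → 0 ≤ a → a < b →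
      |eulerDefect x (fun u => u ^ ((l : ℝ) + β)) a b| / (1 + x * (b - a))
        ≤ C * Real.Gamma (l + β + 1) * ((b - a) ^ 2 * b ^ ((l : ℝ) + β - 1)) / (1 + x * b))
    (hp : 1 < p + β) (hT : 0 ≤ T) (hg : IntervalIntegrable g volume 0 T) {x a b S : ℝ}
    (hx : 0 ≤ x) (ha : 0 ≤ a) (hab : a < b) (hbT : b ≤ T) (hS0 : 0 ≤ S)
    (hS : ∀ u ∈ Ioc 0 b, ‖g u‖ ≤ S) :
    ‖eulerDefect x (fracTaylor β T p v g) a b‖ / (1 + x * (b - a))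
      ≤ (b - a) ^ 2 * (∑ l ∈ Finset.range (p + 1), C * b ^ ((l : ℝ) + β - 1) * ‖v l‖
        + 4 * b ^ (p + β) * S) / (1 + x * b) := by
  have hγ : ∀ l : ℕ, -1 < (l : ℝ) + β := fun l => by
    have : (0 : ℝ) ≤ l := Nat.cast_nonneg l
    linarith
  have hG : ∀ l : ℕ, 0 < Real.Gamma (l + β + 1) := fun l =>
    Real.Gamma_pos_of_pos (by linarith [hγ l])
  have hba : 0 ≤ x * (b - a) := mul_nonneg hx (by linarith)
  have hfi : ∀ (l : ℕ) (s : ℝ), IntervalIntegrable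
      (fun u : ℝ => u ^ ((l : ℝ) + β) • ((1 / Real.Gamma (l + β + 1)) • v l)) volume 0 s :=
    fun l s => by
      have h := intervalIntegral.intervalIntegrable_rpow' (a := 0) (b := s) (hγ l)
      exact ⟨Integrable.smul_const h.1 _, Integrable.smul_const h.2 _⟩
  have hsum : ∀ s : ℝ, IntervalIntegrable (fun u : ℝ => ∑ l ∈ Finset.range (p + 1),
      u ^ ((l : ℝ) + β) • ((1 / Real.Gamma (l + β + 1)) • v l)) volume 0 s := fun s => by
    have := IntervalIntegrable.sum (Finset.range (p + 1)) (μ := volume) (a := 0) (b := s)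
      fun l _ => hfi l s
    convert! this using 1
    funext u; simp
  have e : eulerDefect x (fracTaylor β T p v g) a b
      = ∑ l ∈ Finset.range (p + 1), eulerDefect x (fun u => u ^ ((l : ℝ) + β)) a b •
          ((1 / Real.Gamma (l + β + 1)) • v l)
        + eulerDefect x (fun s => ∫ u in (0 : ℝ)..s,
          (1 / Real.Gamma (p + β)) • truncConv (p + β - 1) T g u) a b := by
    unfold fracTaylor
    rw [eulerDefect_add hsum
      (fun s => (continuous_fracTaylor_remainder hp hT hg).intervalIntegrable _ _),
      eulerDefect_sum _ hfi]
    simp only [eulerDefect_smul_const]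
  have hrem := norm_eulerDefect_truncConv_le hp hT hg hx ha hab hbT hS0 hS
  have hb := ha.trans_lt hab
  rw [e]
  calc _ ≤ (∑ l ∈ Finset.range (p + 1), |eulerDefect x (fun u => u ^ ((l : ℝ) + β)) a b| *
          ((1 / Real.Gamma (l + β + 1)) * ‖v l‖)
        + 4 * ((b - a) ^ 2 * b ^ (p + β) * S) / (1 + x * b)) / (1 + x * (b - a)) := by
        refine div_le_div_of_nonneg_right ((norm_add_le _ _).trans (add_le_add
          ((norm_sum_le _ _).trans (Finset.sum_le_sum fun l _ => ?_)) hrem)) (by positivity)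
        rw [norm_smul, norm_smul, Real.norm_eq_abs,
          Real.norm_of_nonneg (one_div_nonneg.2 (hG l).le)]
    _ ≤ ∑ l ∈ Finset.range (p + 1), (b - a) ^ 2 * (C * b ^ ((l : ℝ) + β - 1) * ‖v l‖)
          / (1 + x * b) + 4 * ((b - a) ^ 2 * b ^ (p + β) * S) / (1 + x * b) := by
        rw [add_div, Finset.sum_div]
        refine add_le_add (Finset.sum_le_sum fun l _ => ?_) (div_le_self ?_ (by linarith))
        · have h1 := mul_le_mul_of_nonneg_right (hC l x a b hx ha hab)
            (mul_nonneg (one_div_nonneg.2 (hG l).le) (norm_nonneg (v l)))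
          rw [mul_div_right_comm]
          refine h1.trans (le_of_eq ?_)
          have := (hG l).ne'
          field_simp
        · have := Real.rpow_nonneg hb.le (p + β)
          positivity
    _ = _ := by
        rw [← Finset.sum_div, ← Finset.mul_sum]; ring

end Error

end

/-! ### Assembly of the error estimate -/

theorem mainTheorem1 (α β M : ℝ) (hα₀ : 0 < α) (hα₁ : α < 1) (hβ : -1 < β) (hM : 0 < M) :
    ∃ C : ℝ, 0 < C ∧
      ∀ (X Y : Type*) [NormedAddCommGroup X] [NormedSpace ℂ X] [CompleteSpace X]
        [NormedAddCommGroup Y] [NormedSpace ℂ Y] [CompleteSpace Y]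
        (K : ℂ → X →L[ℂ] Y) (k : ℝ → X →L[ℂ] Y) (f : ℝ → X) (p : ℕ)
        (T : ℝ) (N : ℕ) (t : ℕ → ℝ),
        SectorialSymbol α M K →
        IsLaplaceTransform k K →
        1 - β < (p : ℝ) →
        IsTimeMesh t N T →
        (∃ B : ℝ, ∀ s ∈ Ioc 0 T, ‖rlDeriv T (p + β + 1) f s‖ ≤ B) →
        (∀ s ∈ Ioc 0 T,
          f s = ∑ l ∈ Finset.range (p + 1),
                  (s ^ ((l : ℝ) + β) / Real.Gamma (l + β + 1)) • rlDerivZero T (l + β) f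
                + (1 / Real.Gamma (p + β + 1)) •
                  ∫ u in (0 : ℝ)..s, (s - u) ^ ((p : ℝ) + β) • rlDeriv T (p + β + 1) f u) →
        ∃ ξ : ℕ → ℝ, (∀ j, 2 ≤ j → j ≤ N → ξ j ∈ Ioo (t (j - 1)) (t j)) ∧
          ∀ n, 1 ≤ n → n ≤ N →
            ‖convolve k f (t n) - gCQ K t f n‖ ≤
              C * ∑ l ∈ Finset.range (p + 1),
                  (stepSize t 1 ^ ((l : ℝ) + α + β)
                    + ∑ j ∈ Finset.Icc 2 n,
                        stepSize t j ^ 2 * ξ j ^ ((l : ℝ) + α + β - 2))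
                  * ‖rlDerivZero T (l + β) f‖
              + C * (stepSize t 1 ^ ((p : ℝ) + α + β + 1)
                      * supNorm (rlDeriv T (p + β + 1) f) (t 1)
                    + ∑ j ∈ Finset.Icc 2 n,
                        stepSize t j ^ 2 * ξ j ^ ((p : ℝ) + α + β - 1)
                          * supNorm (rlDeriv T (p + β + 1) f) (t j)) := by
  obtain ⟨C, hC0, hC⟩ := exists_uniform_eulerDefect_rpow_le hβ
  set W : ℝ := M / Real.pi * ∫ x in Ioi (0 : ℝ), x ^ (-α) / (1 + x) with hW
  have hW0 : 0 ≤ W :=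
    mul_nonneg (div_nonneg hM.le Real.pi_pos.le) (integral_rpow_div_one_add_nonneg α)
  -- `C` belongs to the powers, `4` to the remainder, and `2` to the passage from `t_j` to `ξ_j`;
  -- the added `1` secures positivity.
  refine ⟨W * (2 * (C + 4)) + 1, by positivity, ?_⟩
  intro X Y _ _ _ _ _ _ K k f p T N t hK hk hp hmesh ⟨B, hB⟩ hf
  set g := rlDeriv T (p + β + 1) f with hg_def
  set v : ℕ → X := fun l => rlDerivZero T (l + β) f with hv
  have hp1 : 1 < (p : ℝ) + β := by linarith
  have hξ : ∀ j, ∃ ξ : ℝ, 2 ≤ j → j ≤ N → ξ ∈ Ioo (t (j - 1)) (t j) ∧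
      ∀ l ∈ Finset.range (p + 2),
        t j ^ ((l : ℝ) + α + β - 2) ≤ 2 * ξ ^ ((l : ℝ) + α + β - 2) := fun j => by
    by_cases h : 2 ≤ j ∧ j ≤ N
    · obtain ⟨ξ, h1, h2⟩ := exists_mem_Ioo_rpow_le (hmesh.pos (by omega) h.2)
        (sub_pos.1 (hmesh.stepSize_pos (by omega) h.2))
        ((Finset.range (p + 2)).image fun l : ℕ => (l : ℝ) + α + β - 2)
      exact ⟨ξ, fun _ _ => ⟨h1, fun l hl => h2 _ (Finset.mem_image_of_mem _ hl)⟩⟩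
    · exact ⟨0, fun h1 h2 => absurd ⟨h1, h2⟩ h⟩
  choose ξ hξ using hξ
  refine ⟨ξ, fun j h1 h2 => (hξ j h1 h2).1, fun n hn hnN => ?_⟩
  have hT : 0 ≤ T := by rw [← hmesh.last]; exact hmesh.nonneg le_rfl
  have hgi : IntervalIntegrable g volume 0 T :=
    intervalIntegrable_of_bounded hT (aestronglyMeasurable_rlDeriv T (by linarith) f) hB
  have hfF : EqOn f (fracTaylor β T p v g) (Ioc 0 T) := fun s hs => by
    rw [hf s hs, fracTaylor, integral_truncConv_div_Gamma hp1 hT hgi hs.1.le hs.2]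
    congr 1
    refine Finset.sum_congr rfl fun l _ => ?_
    rw [smul_smul, mul_one_div]
  have htn : 0 < t n := hmesh.pos hn hnN
  have htT : t n ≤ T := hmesh.le_last hnN
  have hstep : ∀ l, 1 ≤ l → l ≤ n → 0 < stepSize t l := fun l h1 h2 =>
    hmesh.stepSize_pos h1 (h2.trans hnN)
  obtain ⟨B', hB'0, hB'⟩ := exists_norm_fracTaylor_le (v := v) hp1 hT hgi
  have hfm : AEStronglyMeasurable f (volume.restrict (Ioc 0 (t n))) :=
    (((continuousOn_fracTaylor hp1 hT hgi).mono fun s hs => hs.1).congr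
      (hfF.mono (Ioc_subset_Ioc_right htT))).aestronglyMeasurable measurableSet_Ioc
  have hfB : ∀ s ∈ Ioc 0 (t n), ‖f s‖ ≤ B' * s ^ min β 0 := fun s hs => by
    have hs' : s ∈ Ioc 0 T := ⟨hs.1, hs.2.trans htT⟩
    rw [hfF hs']; exact hB' s hs'
  set S : ℕ → ℝ := fun j => supNorm g (t j) with hS
  set A : ℕ → ℝ := fun j => stepSize t j ^ 2 *
    (∑ l ∈ Finset.range (p + 1), C * t j ^ ((l : ℝ) + β - 1) * ‖v l‖
      + 4 * t j ^ ((p : ℝ) + β) * S j) with hA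
  have herr := norm_convolve_sub_gCQ_le (A := A) hK hα₀ hα₁ (lt_min hβ (by norm_num)) hk
    (fun j h1 h2 => hmesh.pos h1 (h2.trans hnN)) hn hstep hB'0 hfm hfB fun x hx => by
      rw [expConv_sub_eulerApprox t f x hmesh.zero n fun j h1 h2 => by
        have := mul_pos (hstep j h1 h2) hx; positivity]
      refine (norm_sum_le _ _).trans (Finset.sum_le_sum fun j hj => ?_)
      rw [Finset.mem_Icc] at hj
      have hjN := hj.2.trans hnN
      have hj0 := hmesh.nonneg (j := j - 1) (by omega)
      have hjl : t (j - 1) < t j := sub_pos.1 (hmesh.stepSize_pos hj.1 hjN)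
      have hjT := hmesh.le_last hjN
      have hnn : ∀ l, j ≤ l → l ≤ n → 0 ≤ stepSize t l := fun l h1 h2 =>
        (hstep l (hj.1.trans h1) h2).le
      rw [norm_smul, Real.norm_of_nonneg (eulerFactor_nonneg hx.le hnn),
        eulerDefect_congr hj0 hjl (hfF.mono (Ioc_subset_Ioc_right hjT))]
      refine (mul_le_mul_of_nonneg_right (eulerFactor_le hx.le hj.2 hnn) (norm_nonneg _)).trans ?_
      have := norm_eulerDefect_fracTaylor_le (v := v) hβ hC hp1 hT hgi hx.le hj0 hjl hjT
        (supNorm_nonneg g (t j)) fun u hu => norm_le_supNorm hB hjT hu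
      rw [one_div_mul_eq_div, mul_comm _ x]
      exact this
  refine herr.trans ?_
  rw [← hW]
  set P : ℕ → ℕ → ℝ := fun l j => stepSize t j ^ 2 * t j ^ ((l : ℝ) + α + β - 2) with hP
  have ht1 : stepSize t 1 = t 1 := by simp [stepSize, hmesh.zero]
  -- The first step needs no `ξ`: since `τ_1 = t_1`, the generic term collapses to a pure power of
  -- `τ_1`.
  have hP1 : ∀ l : ℕ, P l 1 = stepSize t 1 ^ ((l : ℝ) + α + β) := fun l => by
    have h1 : 0 < t 1 := hmesh.pos le_rfl (hn.trans hnN)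
    simp only [hP]
    rw [ht1, ← Real.rpow_natCast, ← Real.rpow_add h1]
    congr 1; push_cast; ring
  have hPj : ∀ l ∈ Finset.range (p + 2), ∀ j ∈ Finset.Icc 2 n,
      P l j ≤ 2 * (stepSize t j ^ 2 * ξ j ^ ((l : ℝ) + α + β - 2)) := fun l hl j hj => by
    rw [Finset.mem_Icc] at hj
    have := (hξ j hj.1 (hj.2.trans hnN)).2 l hl
    have := mul_le_mul_of_nonneg_left this (sq_nonneg (stepSize t j))
    simp only [hP]
    linarith
  have hξ0 : ∀ j ∈ Finset.Icc 2 n, 0 ≤ ξ j := fun j hj => by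
    rw [Finset.mem_Icc] at hj
    exact (hmesh.nonneg (j := j - 1) (by omega)).trans (hξ j hj.1 (hj.2.trans hnN)).1.1.le
  have hAj : ∀ j ∈ Finset.Icc 1 n, A j * t j ^ (α - 1)
      = ∑ l ∈ Finset.range (p + 1), C * (P l j * ‖v l‖) + 4 * (P (p + 1) j * S j) := by
    intro j hj
    rw [Finset.mem_Icc] at hj
    have hj0 : 0 < t j := hmesh.pos hj.1 (hj.2.trans hnN)
    have e1 : ∀ l : ℕ, t j ^ ((l : ℝ) + α + β - 2)
        = t j ^ ((l : ℝ) + β - 1) * t j ^ (α - 1) := fun l => by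
      rw [← Real.rpow_add hj0]; congr 1; ring
    have e2 : t j ^ (((p + 1 : ℕ) : ℝ) + α + β - 2)
        = t j ^ ((p : ℝ) + β) * t j ^ (α - 1) := by
      rw [← Real.rpow_add hj0]; congr 1; push_cast; ring
    simp only [hA, hP]
    rw [e2, mul_add, add_mul, Finset.mul_sum, Finset.sum_mul]
    congr 1
    · refine Finset.sum_congr rfl fun l _ => ?_
      rw [e1]; ring
    · ring
  rw [Finset.sum_congr rfl hAj, Finset.sum_add_distrib, Finset.sum_comm]
  have hsplit : ∀ F : ℕ → ℝ, ∑ j ∈ Finset.Icc 1 n, F j = F 1 + ∑ j ∈ Finset.Icc 2 n, F j :=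
    fun F => by
      rw [← Finset.insert_Icc_add_one_left_eq_Icc hn, Finset.sum_insert (by simp)]
      rfl
  set D : ℝ := W * (2 * (C + 4)) + 1 with hD
  have hDC : W * C * 2 ≤ D := by rw [hD]; nlinarith
  have hD4 : W * 4 * 2 ≤ D := by rw [hD]; nlinarith [mul_nonneg hW0 hC0]
  clear_value D
  -- One estimate serves both parts: weights `‖v l‖` for the powers, and `S` with `l = p + 1` for
  -- the remainder.
  have hbound : ∀ l ∈ Finset.range (p + 2), ∀ (w : ℝ) (s : ℕ → ℝ), 0 ≤ w → w * 2 ≤ D →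
      (∀ j, 0 ≤ s j) → w * ∑ j ∈ Finset.Icc 1 n, P l j * s j
        ≤ D * (stepSize t 1 ^ ((l : ℝ) + α + β) * s 1
          + ∑ j ∈ Finset.Icc 2 n, stepSize t j ^ 2 * ξ j ^ ((l : ℝ) + α + β - 2) * s j) := by
    intro l hl w s hw hwD hs
    have hs1 : 0 ≤ stepSize t 1 ^ ((l : ℝ) + α + β) * s 1 :=
      mul_nonneg (Real.rpow_nonneg (hstep 1 le_rfl hn).le _) (hs 1)
    have hs2 : 0 ≤ ∑ j ∈ Finset.Icc 2 n,
        stepSize t j ^ 2 * ξ j ^ ((l : ℝ) + α + β - 2) * s j :=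
      Finset.sum_nonneg fun j hj => mul_nonneg
        (mul_nonneg (sq_nonneg _) (Real.rpow_nonneg (hξ0 j hj) _)) (hs j)
    have h1 : ∑ j ∈ Finset.Icc 1 n, P l j * s j
        ≤ 2 * (stepSize t 1 ^ ((l : ℝ) + α + β) * s 1
          + ∑ j ∈ Finset.Icc 2 n, stepSize t j ^ 2 * ξ j ^ ((l : ℝ) + α + β - 2) * s j) := by
      rw [hsplit, hP1, mul_add, Finset.mul_sum]
      refine add_le_add (by linarith) (Finset.sum_le_sum fun j hj => ?_)
      rw [← mul_assoc]
      exact mul_le_mul_of_nonneg_right (hPj l hl j hj) (hs j)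
    calc _ ≤ w * (2 * _) := mul_le_mul_of_nonneg_left h1 hw
      _ = (w * 2) * _ := by ring
      _ ≤ _ := mul_le_mul_of_nonneg_right hwD (add_nonneg hs1 hs2)
  rw [mul_add]
  refine add_le_add ?_ ?_
  · rw [Finset.mul_sum, Finset.mul_sum]
    refine Finset.sum_le_sum fun l hl => ?_
    have h := hbound l (Finset.mem_range.2 (by have := Finset.mem_range.1 hl; omega)) (W * C)
      (fun _ => ‖v l‖) (mul_nonneg hW0 hC0) hDC fun _ => norm_nonneg _
    rw [← Finset.mul_sum, ← mul_assoc, add_mul, Finset.sum_mul]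
    exact h
  · have h := hbound (p + 1) (by simp) (W * 4) S (by positivity) hD4
      fun j => supNorm_nonneg g (t j)
    rw [← Finset.mul_sum, ← mul_assoc]
    rw [show ((p + 1 : ℕ) : ℝ) + α + β = (p : ℝ) + α + β + 1 by push_cast; ring,
      show (p : ℝ) + α + β + 1 - 2 = (p : ℝ) + α + β - 1 by ring] at h
    exact h
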